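/- Let $d_1,d_2,d_3\ge 1$ be integers, $d=d_1+d_2+d_3$. For real $d_1\times d_2\times d_3$ tensors put $\langle X,Y\rangle=\sum_{a,b,c}X(a,b,c)Y(a,b,c)$, $\|X\|_{\max}=\max_{a,b,c}|X(a,b,c)|$, $\|X\|=\max\{\langle X,u\otimes v\otimes w\rangle:\|u\|=\|v\|=\|w\|=1\}$ (Euclidean unit vectors $u\in\mathbb R^{d_1},v\in\mathbb R^{d_2},w\in\mathbb R^{d_3}$) and $\|X\|_*=\max\{\langle Y,X\rangle:\|Y\|\le 1\}$. For a tensor $T$ and $j=1,2,3$ let $\mathcal L_j(T)\subseteq\mathbb R^{d_j}$ be the linear span of the mode-$j$ fibers of $T$, $r_j=\dim\mathcal L_j(T)$, let $P^j$ be the orthogonal projection onto $\mathcal L_j(T)$ and $P^j_\perp$ the one onto its orthogonal complement, and put $$\bar r(T)=\sqrt{(r_1r_2d_3+r_1r_3d_2+r_2r_3d_1)/d},\qquad Q^0_T=P^1\otimes P^2\otimes P^3,$$ $$Q_T=Q^0_T+P^1_\perp\otimes P^2\otimes P^3+P^1\otimes P^2_\perp\otimes P^3+P^1\otimes P^2\otimes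 P^3_\perp .$$ Let $W$ be a tensor with $Q^0_TW=W$, $\|W\|=1$ and $\langle T,W\rangle=\|T\|_*$, and let $\alpha(T)=\sqrt{d_1d_2d_3/\bar r(T)}\,\|W\|_{\max}$. Let $\omega_1,\dots,\omega_{n_1}$ be independent and uniformly distributed on $[d_1]\times[d_2]\times[d_3]$, and let $$\mathcal R_1X=X-\frac1{n_1}\sum_{i=1}^{n_1}(d_1d_2d_3)\,\mathcal P_{\omega_i}X,$$ where $\mathcal P_{\omega}X$ has the same entry as $X$ at position $\omega$ and all its other entries are zero. There exists a numerical constant $c_1>0$ (independent of $d_1,d_2,d_3,T,W$ and of all the parameters below) with the following property. Suppose that $\alpha(T)\le\alpha_0$ and $\bar r(T)=r$, let $\beta>0$ and $1/\log d\le\delta_1<1$, and put $q_1^*=(\beta+\log d)^2\alpha_0^2\,r\log d$. If $$n_1\ge c_1\Big[q_1^*d^{1+\delta_1}+\sqrt{q_1^*(1+\beta)\delta_1^{-1}d_1d_2d_3}\Big],$$ then $$\max_{X:\;X=Q_TX,\ \|X\|_{\max}\le\|W\|_{\max}}\mathbb P\Big\{\|\mathcal R_1X\|\ge\tfrac18\Big\}\le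 d^{-\beta-1}.$$ -/

import Mathlib

open MeasureTheory ProbabilityTheory

/-- Positions `(a, b, c)` of the entries of a `d₁ × d₂ × d₃` tensor. -/
abbrev TIdx (d₁ d₂ d₃ : ℕ) : Type := Fin d₁ × Fin d₂ × Fin d₃

/-- Real third order tensors of size `d₁ × d₂ × d₃`. -/
abbrev Tensor3 (d₁ d₂ d₃ : ℕ) : Type := Fin d₁ → Fin d₂ → Fin d₃ → ℝ

namespace Tensor3

noncomputable section

variable {d₁ d₂ d₃ : ℕ}

/-- The inner product `⟨X, Y⟩ = ∑ X(a,b,c) Y(a,b,c)`. -/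
def dot (X Y : Tensor3 d₁ d₂ d₃) : ℝ := ∑ a, ∑ b, ∑ c, X a b c * Y a b c

/-- The rank one tensor `u ⊗ v ⊗ w`. -/
def outer (u : EuclideanSpace ℝ (Fin d₁)) (v : EuclideanSpace ℝ (Fin d₂))
    (w : EuclideanSpace ℝ (Fin d₃)) : Tensor3 d₁ d₂ d₃ := fun a b c => u a * v b * w c

/-- The tensor spectral norm: the maximum of `⟨X, u ⊗ v ⊗ w⟩` over Euclidean unit vectors. -/
def spectralNorm (X : Tensor3 d₁ d₂ d₃) : ℝ :=
  sSup {x : ℝ | ∃ (u : EuclideanSpace ℝ (Fin d₁)) (v : EuclideanSpace ℝ (Fin d₂))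
    (w : EuclideanSpace ℝ (Fin d₃)), ‖u‖ = 1 ∧ ‖v‖ = 1 ∧ ‖w‖ = 1 ∧ x = dot X (outer u v w)}

/-- The tensor nuclear norm: the maximum of `⟨Y, X⟩` over `Y` of spectral norm at most one. -/
def nuclearNorm (X : Tensor3 d₁ d₂ d₃) : ℝ :=
  sSup {x : ℝ | ∃ Y : Tensor3 d₁ d₂ d₃, spectralNorm Y ≤ 1 ∧ x = dot Y X}

/-- The entrywise maximum norm. -/
def maxNorm (X : Tensor3 d₁ d₂ d₃) : ℝ := ⨆ ω : TIdx d₁ d₂ d₃, |X ω.1 ω.2.1 ω.2.2|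

/-- The mode-1 fiber `X(·, b, c)`. -/
def fiber₁ (X : Tensor3 d₁ d₂ d₃) (b : Fin d₂) (c : Fin d₃) : EuclideanSpace ℝ (Fin d₁) :=
  WithLp.toLp 2 (fun a => X a b c)

/-- The mode-2 fiber `X(a, ·, c)`. -/
def fiber₂ (X : Tensor3 d₁ d₂ d₃) (a : Fin d₁) (c : Fin d₃) : EuclideanSpace ℝ (Fin d₂) :=
  WithLp.toLp 2 (fun b => X a b c)

/-- The mode-3 fiber `X(a, b, ·)`. -/
def fiber₃ (X : Tensor3 d₁ d₂ d₃) (a : Fin d₁) (b : Fin d₂) : EuclideanSpace ℝ (Fin d₃) :=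
  WithLp.toLp 2 (fun c => X a b c)

/-- The linear span of the mode-1 fibers. -/
def fiberSpan₁ (X : Tensor3 d₁ d₂ d₃) : Submodule ℝ (EuclideanSpace ℝ (Fin d₁)) :=
  Submodule.span ℝ {x | ∃ b c, x = fiber₁ X b c}

/-- The linear span of the mode-2 fibers. -/
def fiberSpan₂ (X : Tensor3 d₁ d₂ d₃) : Submodule ℝ (EuclideanSpace ℝ (Fin d₂)) :=
  Submodule.span ℝ {x | ∃ a c, x = fiber₂ X a c}

/-- The linear span of the mode-3 fibers. -/
def fiberSpan₃ (X : Tensor3 d₁ d₂ d₃) : Submodule ℝ (EuclideanSpace ℝ (Fin d₃)) :=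
  Submodule.span ℝ {x | ∃ a b, x = fiber₃ X a b}

/-- The Tucker ranks. -/
def tuckerRank₁ (X : Tensor3 d₁ d₂ d₃) : ℕ := Module.finrank ℝ (fiberSpan₁ X)

/-- The second Tucker rank. -/
def tuckerRank₂ (X : Tensor3 d₁ d₂ d₃) : ℕ := Module.finrank ℝ (fiberSpan₂ X)

/-- The third Tucker rank. -/
def tuckerRank₃ (X : Tensor3 d₁ d₂ d₃) : ℕ := Module.finrank ℝ (fiberSpan₃ X)

/-- The averaged rank `√((r₁ r₂ d₃ + r₁ r₃ d₂ + r₂ r₃ d₁) / (d₁ + d₂ + d₃))`. -/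
def rbar (X : Tensor3 d₁ d₂ d₃) : ℝ :=
  √(((tuckerRank₁ X : ℝ) * tuckerRank₂ X * d₃ + (tuckerRank₁ X : ℝ) * tuckerRank₃ X * d₂
    + (tuckerRank₂ X : ℝ) * tuckerRank₃ X * d₁) / ((d₁ : ℝ) + d₂ + d₃))

/-- Marginal multiplication in the first coordinate by a linear map: each mode-1 fiber is
multiplied by `M`. -/
def mul₁ (M : EuclideanSpace ℝ (Fin d₁) →L[ℝ] EuclideanSpace ℝ (Fin d₁))
    (X : Tensor3 d₁ d₂ d₃) : Tensor3 d₁ d₂ d₃ := fun a b c => M (fiber₁ X b c) a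

/-- Marginal multiplication in the second coordinate. -/
def mul₂ (M : EuclideanSpace ℝ (Fin d₂) →L[ℝ] EuclideanSpace ℝ (Fin d₂))
    (X : Tensor3 d₁ d₂ d₃) : Tensor3 d₁ d₂ d₃ := fun a b c => M (fiber₂ X a c) b

/-- Marginal multiplication in the third coordinate. -/
def mul₃ (M : EuclideanSpace ℝ (Fin d₃) →L[ℝ] EuclideanSpace ℝ (Fin d₃))
    (X : Tensor3 d₁ d₂ d₃) : Tensor3 d₁ d₂ d₃ := fun a b c => M (fiber₃ X a b) c

/-- The map `M₁ ⊗ M₂ ⊗ M₃` on tensors; see `prodMap_outer` for its value at `u ⊗ v ⊗ w`. -/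
def prodMap (M₁ : EuclideanSpace ℝ (Fin d₁) →L[ℝ] EuclideanSpace ℝ (Fin d₁))
    (M₂ : EuclideanSpace ℝ (Fin d₂) →L[ℝ] EuclideanSpace ℝ (Fin d₂))
    (M₃ : EuclideanSpace ℝ (Fin d₃) →L[ℝ] EuclideanSpace ℝ (Fin d₃))
    (X : Tensor3 d₁ d₂ d₃) : Tensor3 d₁ d₂ d₃ := mul₁ M₁ (mul₂ M₂ (mul₃ M₃ X))

theorem prodMap_outer (M₁ : EuclideanSpace ℝ (Fin d₁) →L[ℝ] EuclideanSpace ℝ (Fin d₁))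
    (M₂ : EuclideanSpace ℝ (Fin d₂) →L[ℝ] EuclideanSpace ℝ (Fin d₂))
    (M₃ : EuclideanSpace ℝ (Fin d₃) →L[ℝ] EuclideanSpace ℝ (Fin d₃))
    (u : EuclideanSpace ℝ (Fin d₁)) (v : EuclideanSpace ℝ (Fin d₂))
    (w : EuclideanSpace ℝ (Fin d₃)) :
    prodMap M₁ M₂ M₃ (outer u v w) = outer (M₁ u) (M₂ v) (M₃ w) := by
  have h3 : mul₃ M₃ (outer u v w) = outer u v (M₃ w) := by
    funext a b c
    have : fiber₃ (outer u v w) a b = (u a * v b) • w := by ext i; simp [fiber₃, outer]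
    simp [mul₃, this, outer]
  have h2 : mul₂ M₂ (outer u v (M₃ w)) = outer u (M₂ v) (M₃ w) := by
    funext a b c
    have : fiber₂ (outer u v (M₃ w)) a c = (u a * M₃ w c) • v := by
      ext i; simp [fiber₂, outer]; ring
    simp [mul₂, this, outer]; ring
  have h1 : mul₁ M₁ (outer u (M₂ v) (M₃ w)) = outer (M₁ u) (M₂ v) (M₃ w) := by
    funext a b c
    have : fiber₁ (outer u (M₂ v) (M₃ w)) b c = (M₂ v b * M₃ w c) • u := by
      ext i; simp [fiber₁, outer]; ring
    simp [mul₁, this, outer]; ring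
  rw [prodMap, h3, h2, h1]

/-- `Q⁰_T = P¹ ⊗ P² ⊗ P³`, with `Pʲ` the orthogonal projection onto the span of the mode-`j`
fibers of `T`. -/
def Q0 (T X : Tensor3 d₁ d₂ d₃) : Tensor3 d₁ d₂ d₃ :=
  prodMap (fiberSpan₁ T).starProjection (fiberSpan₂ T).starProjection
    (fiberSpan₃ T).starProjection X

/-- `Q¹_T = P¹^⊥ ⊗ P² ⊗ P³`. -/
def Q1 (T X : Tensor3 d₁ d₂ d₃) : Tensor3 d₁ d₂ d₃ :=
  prodMap (fiberSpan₁ T)ᗮ.starProjection (fiberSpan₂ T).starProjection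
    (fiberSpan₃ T).starProjection X

/-- `Q²_T = P¹ ⊗ P²^⊥ ⊗ P³`. -/
def Q2 (T X : Tensor3 d₁ d₂ d₃) : Tensor3 d₁ d₂ d₃ :=
  prodMap (fiberSpan₁ T).starProjection (fiberSpan₂ T)ᗮ.starProjection
    (fiberSpan₃ T).starProjection X

/-- `Q³_T = P¹ ⊗ P² ⊗ P³^⊥`. -/
def Q3 (T X : Tensor3 d₁ d₂ d₃) : Tensor3 d₁ d₂ d₃ :=
  prodMap (fiberSpan₁ T).starProjection (fiberSpan₂ T).starProjection
    (fiberSpan₃ T)ᗮ.starProjection X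

/-- `Q_T = Q⁰_T + Q¹_T + Q²_T + Q³_T`. -/
def Q (T X : Tensor3 d₁ d₂ d₃) : Tensor3 d₁ d₂ d₃ := Q0 T X + Q1 T X + Q2 T X + Q3 T X

/-- `W` is a dual tensor of `T`: `W = Q⁰_T W`, `‖W‖ = 1` and `⟨T, W⟩ = ‖T‖_*`. -/
def IsDual (T W : Tensor3 d₁ d₂ d₃) : Prop :=
  Q0 T W = W ∧ spectralNorm W = 1 ∧ dot T W = nuclearNorm T

/-- The coherence `α(T) = √(d₁ d₂ d₃ / r̄(T)) ‖W‖_max`, for the dual tensor `W` of `T` that is in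
use (a dual tensor need not be unique, so `W` is an argument). -/
def alpha (T W : Tensor3 d₁ d₂ d₃) : ℝ :=
  √(((d₁ : ℝ) * d₂ * d₃) / rbar T) * maxNorm W

/-- `P_ω` keeps the entry at position `ω` and puts all the others to zero. -/
def entryProj (ω : TIdx d₁ d₂ d₃) (X : Tensor3 d₁ d₂ d₃) : Tensor3 d₁ d₂ d₃ :=
  fun a b c => if (a, b, c) = ω then X a b c else 0

/-- `R X = X - (1/n) ∑ i, (d₁ d₂ d₃) P_{ω i} X` for sampled positions `ω 1, …, ω n`. -/
def sampleR {n : ℕ} (ω : Fin n → TIdx d₁ d₂ d₃) (X : Tensor3 d₁ d₂ d₃) : Tensor3 d₁ d₂ d₃ :=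
  X - (1 / (n : ℝ)) • ∑ i, ((d₁ : ℝ) * d₂ * d₃) • entryProj (ω i) X

end

end Tensor3

/-- `q₁* = (β + log d)² α₀² r log d`. -/
noncomputable def qStar (β α₀ r d : ℝ) : ℝ :=
  (β + Real.log d) ^ 2 * α₀ ^ 2 * r * Real.log d

/-! Write D = d₁d₂d₃, n = n₁ and M = ‖W‖_max. The deviation of a tensor with entries bounded by M is
a trilinear form in (u, v, w), to be bounded over all unit vectors at once. One net of e^{Cd} points
is too expensive: Bernstein's linear term would be of order M·D·d/n, because u ⊗ v ⊗ w may have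
entries as large as 1. The cost is therefore made to depend on the support of the vectors.

The entries of u, v, w are rounded to 0 or ±2⁻ᵏ, which costs a factor 64 (`trilinear_le_of_digits`).
The form is split according to which of the three entries is smallest. Where it is that of u, the
sum is cut into blocks: the entry of u has modulus 2⁻ᵏ and the product of the other two has modulus
2⁻ˢ (`region_entry`). A block is 2⁻ᵏ⁻ˢ times a pattern of signs, and Bernstein's inequality applies
at exponent E₀ + θ · (number of nonzero entries). The weights exp(-θ · nnz) sum to at most e over
all digit vectors (`sum_exp_nnz_le`), so the union bound over all patterns is affordable with θ of
order log d.

The deterministic part (`abs_block_le`, `abs_region_le`) sums the blocks. The linear Bernstein terms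
decay like 2^{-|k-s|} times weighted support sizes, which the Euclidean norms control; for s < k the
signed bound is supplemented by a count of the samples in the level. The square root terms are
summed by Cauchy–Schwarz and cost a factor of order log d. With D·M² ≤ α₀²r from the coherence, both
kinds of term are small under the assumed sample size (`regionBound_lt`). -/

namespace Tensor3

/-! ### Rounding unit vectors to dyadic digits. -/

/-- The values `0` and `± 2⁻ᵏ`, `k < K`. -/
noncomputable def digits (K : ℕ) : Finset ℝ :=
  insert 0 ((Finset.range K).image (fun k => (1 / 2 : ℝ) ^ k) ∪
    (Finset.range K).image (fun k => -(1 / 2 : ℝ) ^ k))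

theorem mem_digits {K : ℕ} {x : ℝ} :
    x ∈ digits K ↔ x = 0 ∨ ∃ k < K, |x| = (1 / 2 : ℝ) ^ k := by
  simp only [digits, Finset.mem_insert, Finset.mem_union, Finset.mem_image, Finset.mem_range]
  refine or_congr_right ⟨?_, ?_⟩
  · rintro (⟨k, hk, rfl⟩ | ⟨k, hk, rfl⟩)
    · exact ⟨k, hk, abs_of_pos (by positivity)⟩
    · exact ⟨k, hk, by rw [abs_neg]; exact abs_of_pos (by positivity)⟩
  · rintro ⟨k, hk, h⟩
    rcases abs_choice x with h' | h'
    · exact Or.inl ⟨k, hk, by rw [← h, h']⟩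
    · exact Or.inr ⟨k, hk, by rw [← h, h']; ring⟩

theorem zero_mem_digits (K : ℕ) : (0 : ℝ) ∈ digits K := mem_digits.2 (Or.inl rfl)

theorem card_digits_erase (K : ℕ) : ((digits K).erase 0).card ≤ 2 * K := by
  refine (Finset.card_le_card (Finset.erase_insert_subset _ _)).trans ?_
  refine (Finset.card_union_le _ _).trans ?_
  have h1 := Finset.card_image_le (s := Finset.range K) (f := fun k => (1 / 2 : ℝ) ^ k)
  have h2 := Finset.card_image_le (s := Finset.range K) (f := fun k => -(1 / 2 : ℝ) ^ k)
  rw [Finset.card_range] at h1 h2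
  omega

theorem half_pow_inj {k l : ℕ} (h : (1 / 2 : ℝ) ^ k = (1 / 2 : ℝ) ^ l) : k = l :=
  pow_right_injective₀ (by norm_num) (by norm_num) h

theorem half_pow_le_iff {k l : ℕ} : (1 / 2 : ℝ) ^ k ≤ (1 / 2 : ℝ) ^ l ↔ l ≤ k :=
  pow_le_pow_iff_right_of_lt_one₀ (by norm_num) (by norm_num)

/-- Every number in `[-1, 1]` of size at least `2⁻ᴷ` is within a factor two of a digit. -/
theorem exists_digit (K : ℕ) {x : ℝ} (hx : |x| ≤ 1) :
    ∃ y ∈ digits (K + 1), y ^ 2 ≤ x ^ 2 ∧ (x ^ 2 - (1 / 4) ^ K) / 2 ≤ x * y := by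
  by_cases h : |x| < (1 / 2) ^ K
  · refine ⟨0, zero_mem_digits _, by simpa using sq_nonneg x, ?_⟩
    have : x ^ 2 ≤ (1 / 4) ^ K := by
      rw [← sq_abs, show (1 / 4 : ℝ) = (1 / 2) ^ 2 by norm_num, ← pow_mul, mul_comm, pow_mul]
      gcongr
    linarith
  · push Not at h
    have hx0 : 0 < |x| := lt_of_lt_of_le (by positivity) h
    obtain ⟨n, hn1, hn2⟩ := exists_nat_pow_near_of_lt_one hx0 hx
      (show (0 : ℝ) < 1 / 2 by norm_num) (by norm_num)
    have key : ∃ k < K + 1, (1 / 2 : ℝ) ^ k ≤ |x| ∧ |x| ≤ 2 * (1 / 2) ^ k := by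
      by_cases hnK : n + 1 < K + 1
      · exact ⟨n + 1, hnK, hn1.le, by rw [pow_succ]; linarith⟩
      -- The only remaining case is |x| = 2⁻ᴷ: the strict bound `hn1` pushes n + 1 past the last
      -- digit, and x is a digit itself.
      · refine ⟨K, by omega, h, ?_⟩
        have : (1 / 2 : ℝ) ^ n ≤ (1 / 2) ^ K := half_pow_le_iff.2 (by omega)
        have : (0 : ℝ) < (1 / 2) ^ K := by positivity
        linarith
    obtain ⟨k, hk, h1, h2⟩ := key
    have hp : (0 : ℝ) < (1 / 2) ^ k := by positivity
    have hs : |((SignType.sign x : SignType) : ℝ)| = 1 := by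
      rcases lt_or_gt_of_ne (abs_pos.1 hx0) with h | h <;> simp [h]
    refine ⟨(SignType.sign x : ℝ) * (1 / 2) ^ k, mem_digits.2 (Or.inr ⟨k, hk, ?_⟩), ?_, ?_⟩
    · rw [abs_mul, hs, abs_of_pos hp, one_mul]
    · rw [mul_pow, ← sq_abs ((SignType.sign x : SignType) : ℝ), hs, ← sq_abs x]
      nlinarith
    · have : x * ((SignType.sign x : ℝ) * (1 / 2) ^ k) = |x| * (1 / 2) ^ k := by
        rw [← mul_assoc, mul_comm x, sign_mul_self]
      rw [this, ← sq_abs]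
      have : (0 : ℝ) < (1 / 4) ^ K := by positivity
      nlinarith

section Rounding

variable {ι : Type*} [Fintype ι]

/-- A linear functional on the unit ball is controlled by its values at digit vectors. -/
theorem linear_le_of_digits (K : ℕ) (hK : (Fintype.card ι : ℝ) * (1 / 4) ^ K ≤ 1 / 2) (y : ι → ℝ)
    (B : ℝ)
    (h : ∀ u : ι → ℝ, (∀ i, u i ∈ digits (K + 1)) → ∑ i, u i ^ 2 ≤ 1 → ∑ i, u i * y i ≤ B)
    (x : ι → ℝ) (hx : ∑ i, x i ^ 2 ≤ 1) : ∑ i, x i * y i ≤ 4 * B := by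
  have hB : 0 ≤ B := by
    simpa using h 0 (fun i => zero_mem_digits _) (by simp)
  set s := √(∑ i, y i ^ 2) with hs
  have hs2 : s ^ 2 = ∑ i, y i ^ 2 := Real.sq_sqrt (by positivity)
  have hCS : ∑ i, x i * y i ≤ s := by
    refine (Real.sum_mul_le_sqrt_mul_sqrt _ _ _).trans ?_
    have : √(∑ i, x i ^ 2) ≤ 1 := Real.sqrt_le_one.2 hx
    exact mul_le_of_le_one_left (Real.sqrt_nonneg _) this
  rcases (Real.sqrt_nonneg (∑ i, y i ^ 2)).eq_or_lt with h0 | h0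
  · rw [← hs] at h0; linarith
  rw [← hs] at h0
  have hsum : ∑ i, (y i / s) ^ 2 = 1 := by
    simp only [div_pow]
    rw [← Finset.sum_div, ← hs2]
    field_simp
  have hle (i : ι) : |y i / s| ≤ 1 := by
    rw [← sq_le_one_iff_abs_le_one, ← hsum]
    exact Finset.single_le_sum (f := fun i => (y i / s) ^ 2) (fun _ _ => by positivity)
      (Finset.mem_univ i)
  -- The maximiser y/s is rounded, not x. Cutting off the entries below 2⁻ᴷ loses at most half of
  -- the squared norm and rounding loses a factor 2, so ⟨y/s, u⟩ ≥ 1/4; hence the factor 4.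
  choose u hu1 hu2 hu3 using fun i => exists_digit K (hle i)
  have h1 := h u hu1 (by rw [← hsum]; exact Finset.sum_le_sum fun i _ => hu2 i)
  have h2 : (1 - Fintype.card ι * (1 / 4) ^ K) / 2 ≤ ∑ i, y i / s * u i := by
    refine le_trans (le_of_eq ?_) (Finset.sum_le_sum fun i _ => hu3 i)
    rw [← Finset.sum_div, Finset.sum_sub_distrib, hsum]
    simp
  have h3 : ∑ i, u i * y i = s * ∑ i, y i / s * u i := by
    rw [Finset.mul_sum]
    refine Finset.sum_congr rfl fun i _ => ?_
    field_simp
  rw [h3] at h1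
  nlinarith

end Rounding

/-- The number of nonzero entries, as a real number. -/
noncomputable def nnz {ι : Type*} [Fintype ι] (u : ι → ℝ) : ℝ := ∑ i, if u i = 0 then 0 else 1

theorem nnz_nonneg {ι : Type*} [Fintype ι] (u : ι → ℝ) : 0 ≤ nnz u :=
  Finset.sum_nonneg fun _ _ => by split_ifs <;> norm_num

theorem nnz_le_card {ι : Type*} [Fintype ι] (u : ι → ℝ) : nnz u ≤ Fintype.card ι := by
  refine (Finset.sum_le_sum fun i _ => (?_ : _ ≤ (1 : ℝ))).trans (by simp)
  split_ifs <;> norm_num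

/-- The form is linear in each vector with the other two frozen, so the vectors can be rounded one
at a time; 64 = 4³. -/
theorem trilinear_le_of_digits {I J H : Type*} [Fintype I] [Fintype J] [Fintype H] (K : ℕ)
    (hI : (Fintype.card I : ℝ) * (1 / 4) ^ K ≤ 1 / 2)
    (hJ : (Fintype.card J : ℝ) * (1 / 4) ^ K ≤ 1 / 2)
    (hH : (Fintype.card H : ℝ) * (1 / 4) ^ K ≤ 1 / 2) (Y : I × J × H → ℝ) (B : ℝ)
    (h : ∀ (u : I → ℝ) (v : J → ℝ) (w : H → ℝ), (∀ i, u i ∈ digits (K + 1)) →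
      (∀ i, v i ∈ digits (K + 1)) → (∀ i, w i ∈ digits (K + 1)) → ∑ i, u i ^ 2 ≤ 1 →
      ∑ i, v i ^ 2 ≤ 1 → ∑ i, w i ^ 2 ≤ 1 → ∑ p, u p.1 * v p.2.1 * w p.2.2 * Y p ≤ B)
    (u : I → ℝ) (v : J → ℝ) (w : H → ℝ) (hu : ∑ i, u i ^ 2 ≤ 1) (hv : ∑ i, v i ^ 2 ≤ 1)
    (hw : ∑ i, w i ^ 2 ≤ 1) : ∑ p, u p.1 * v p.2.1 * w p.2.2 * Y p ≤ 64 * B := by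
  have e1 (u : I → ℝ) (v : J → ℝ) (w : H → ℝ) : ∑ p, u p.1 * v p.2.1 * w p.2.2 * Y p
      = ∑ i, u i * ∑ j, ∑ k, v j * w k * Y (i, j, k) := by
    simp only [Fintype.sum_prod_type, Finset.mul_sum, mul_assoc]
  have e2 (u : I → ℝ) (v : J → ℝ) (w : H → ℝ) : ∑ p, u p.1 * v p.2.1 * w p.2.2 * Y p
      = ∑ j, v j * ∑ i, ∑ k, u i * w k * Y (i, j, k) := by
    simp only [Fintype.sum_prod_type, Finset.mul_sum]
    rw [Finset.sum_comm]
    refine Finset.sum_congr rfl fun _ _ => Finset.sum_congr rfl fun _ _ =>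
      Finset.sum_congr rfl fun _ _ => by ring
  have e3 (u : I → ℝ) (v : J → ℝ) (w : H → ℝ) : ∑ p, u p.1 * v p.2.1 * w p.2.2 * Y p
      = ∑ k, w k * ∑ i, ∑ j, u i * v j * Y (i, j, k) := by
    simp only [Fintype.sum_prod_type, Finset.mul_sum]
    rw [Finset.sum_comm_cycle]
    refine Finset.sum_congr rfl fun _ _ => Finset.sum_congr rfl fun _ _ =>
      Finset.sum_congr rfl fun _ _ => by ring
  have s1 (u : I → ℝ) (hu : ∑ i, u i ^ 2 ≤ 1) (v : J → ℝ) (w : H → ℝ)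
      (hv' : ∀ i, v i ∈ digits (K + 1)) (hw' : ∀ i, w i ∈ digits (K + 1))
      (hv : ∑ i, v i ^ 2 ≤ 1) (hw : ∑ i, w i ^ 2 ≤ 1) :
      ∑ p, u p.1 * v p.2.1 * w p.2.2 * Y p ≤ 4 * B := by
    rw [e1]
    refine linear_le_of_digits K hI _ B (fun u' hu' hu'' => ?_) u hu
    rw [← e1]
    exact h u' v w hu' hv' hw' hu'' hv hw
  have s2 (u : I → ℝ) (hu : ∑ i, u i ^ 2 ≤ 1) (v : J → ℝ) (w : H → ℝ)
      (hw' : ∀ i, w i ∈ digits (K + 1))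
      (hv : ∑ i, v i ^ 2 ≤ 1) (hw : ∑ i, w i ^ 2 ≤ 1) :
      ∑ p, u p.1 * v p.2.1 * w p.2.2 * Y p ≤ 4 * (4 * B) := by
    rw [e2]
    refine linear_le_of_digits K hJ _ _ (fun v' hv' hv'' => ?_) v hv
    rw [← e2]
    exact s1 u hu v' w hv' hw' hv'' hw
  have : 64 * B = 4 * (4 * (4 * B)) := by ring
  rw [e3, this]
  refine linear_le_of_digits K hH _ _ (fun w' hw' hw'' => ?_) w hw
  rw [← e3]
  exact s2 u hu v w' hw' hv hw''

/-! ### Dyadic decomposition of a rank one tensor into sign patterns. -/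

section Level

variable {I J H : Type*}

/-- The indicator of the positions where `|v ⊗ w|` equals `2⁻ˢ`. -/
noncomputable def level (v : J → ℝ) (w : H → ℝ) (s : ℕ) (q : J × H) : ℝ :=
  if |v q.1 * w q.2| = (1 / 2) ^ s then 1 else 0

/-- The sign pattern of `u ⊗ v ⊗ w`, restricted to a level of `v ⊗ w`. -/
noncomputable def signPattern (u : I → ℝ) (v : J → ℝ) (w : H → ℝ) (s : ℕ) (p : I × J × H) : ℝ :=
  (SignType.sign (u p.1) : ℝ) * SignType.sign (v p.2.1) * SignType.sign (w p.2.2) * level v w s p.2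

theorem level_nonneg (v : J → ℝ) (w : H → ℝ) (s : ℕ) (q : J × H) : 0 ≤ level v w s q := by
  unfold level; split_ifs <;> norm_num

theorem level_le_one (v : J → ℝ) (w : H → ℝ) (s : ℕ) (q : J × H) : level v w s q ≤ 1 := by
  unfold level; split_ifs <;> norm_num

theorem abs_sign_cast_le_one (x : ℝ) : |((SignType.sign x : SignType) : ℝ)| ≤ 1 := by
  rcases lt_trichotomy x 0 with h | h | h <;> simp [h]

theorem abs_sign_cast (x : ℝ) : |((SignType.sign x : SignType) : ℝ)| = if x = 0 then 0 else 1 := by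
  rcases lt_trichotomy x 0 with h | h | h
  · simp [h, h.ne]
  · simp [h]
  · simp [h, h.ne']

theorem abs_signPattern_le (u : I → ℝ) (v : J → ℝ) (w : H → ℝ) (s : ℕ) (p : I × J × H) :
    |signPattern u v w s p| ≤ (if u p.1 = 0 then 0 else 1) * level v w s p.2 := by
  rw [signPattern, abs_mul, abs_mul, abs_mul, abs_of_nonneg (level_nonneg v w s p.2),
    abs_sign_cast (u p.1)]
  refine mul_le_mul_of_nonneg_right ?_ (level_nonneg v w s p.2)
  have h1 : |((SignType.sign (v p.2.1) : SignType) : ℝ)| *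
      |((SignType.sign (w p.2.2) : SignType) : ℝ)| ≤ 1 :=
    mul_le_one₀ (abs_sign_cast_le_one _) (abs_nonneg _) (abs_sign_cast_le_one _)
  rw [mul_assoc]
  exact mul_le_of_le_one_right (by split_ifs <;> norm_num) h1

theorem abs_signPattern_le_one (u : I → ℝ) (v : J → ℝ) (w : H → ℝ) (s : ℕ) (p : I × J × H) :
    |signPattern u v w s p| ≤ 1 :=
  (abs_signPattern_le u v w s p).trans
    (mul_le_one₀ (by split_ifs <;> norm_num) (level_nonneg _ _ _ _) (level_le_one _ _ _ _))

theorem sum_geometric_from (m l : ℕ) :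
    ∑ k ∈ Finset.range m, (if l ≤ k then (1 / 2 : ℝ) ^ (k - l) else 0) ≤ 2 := by
  -- The explicit remainder is what lets the induction close.
  have : ∑ k ∈ Finset.range m, (if l ≤ k then (1 / 2 : ℝ) ^ (k - l) else 0)
      ≤ 2 - 2 * (1 / 2) ^ (m - l) := by
    induction m with
    | zero => simp
    | succ m ih =>
      rw [Finset.sum_range_succ]
      by_cases h : l ≤ m
      · rw [if_pos h, Nat.succ_sub h, pow_succ]
        linarith
      · rw [if_neg h, show m + 1 - l = m - l by omega]
        linarith
  have : (0 : ℝ) < (1 / 2) ^ (m - l) := by positivity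
  linarith

theorem sum_quarter_pow_le (K m : ℕ) {x : ℝ} (hx : x ∈ digits K) :
    ∑ k ∈ Finset.range m, (1 / 4 : ℝ) ^ k * (if (1 / 2) ^ k ≤ |x| then 1 else 0) ≤ 2 * x ^ 2 := by
  rcases mem_digits.1 hx with rfl | ⟨l, -, hl⟩
  · refine (Finset.sum_eq_zero fun k _ => ?_).le.trans (by simp)
    rw [if_neg, mul_zero]
    rw [abs_zero, not_le]
    positivity
  · rw [← sq_abs, hl]
    simp only [half_pow_le_iff]
    have h4 (l : ℕ) : (1 / 4 : ℝ) ^ l = ((1 / 2) ^ l) ^ 2 := by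
      rw [← pow_mul, mul_comm, pow_mul]; norm_num
    calc _ ≤ ∑ k ∈ Finset.range m, ((1 / 2 : ℝ) ^ l) ^ 2 *
          (if l ≤ k then (1 / 2 : ℝ) ^ (k - l) else 0) := by
          refine Finset.sum_le_sum fun k _ => ?_
          split_ifs with h
          · obtain ⟨j, rfl⟩ := Nat.exists_eq_add_of_le h
            rw [mul_one, h4, pow_add, Nat.add_sub_cancel_left, mul_pow]
            have h1 : (0 : ℝ) < (1 / 2) ^ j := by positivity
            have h2 : (1 / 2 : ℝ) ^ j ≤ 1 := pow_le_one₀ (by norm_num) (by norm_num)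
            refine mul_le_mul_of_nonneg_left ?_ (by positivity)
            nlinarith
          · simp
      _ ≤ _ := by
        rw [← Finset.mul_sum, mul_comm]
        exact mul_le_mul_of_nonneg_right (sum_geometric_from m l) (by positivity)

/-- `u`, restricted to the entries of modulus `2⁻ᵏ`. -/
noncomputable def exactPart {ι : Type*} (u : ι → ℝ) (k : ℕ) (i : ι) : ℝ :=
  if |u i| = (1 / 2) ^ k then u i else 0

open Classical in
/-- `v`, restricted to the entries of modulus at least `2⁻ᵏ` and `2⁻ˢ` that are related
to `2⁻ᵏ`. -/
noncomputable def largePart {ι : Type*} (R : ℝ → ℝ → Prop) (v : ι → ℝ) (k s : ℕ) (j : ι) : ℝ :=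
  if (1 / 2) ^ (min k s) ≤ |v j| ∧ R ((1 / 2) ^ k) |v j| then v j else 0

theorem exactPart_mem {ι : Type*} {K : ℕ} {u : ι → ℝ} (hu : ∀ i, u i ∈ digits K) (k : ℕ) (i : ι) :
    exactPart u k i ∈ digits K := by
  unfold exactPart; split_ifs
  exacts [hu i, zero_mem_digits K]

theorem largePart_mem {ι : Type*} {K : ℕ} {u : ι → ℝ} (hu : ∀ i, u i ∈ digits K)
    (R : ℝ → ℝ → Prop) (k s : ℕ) (i : ι) : largePart R u k s i ∈ digits K := by
  unfold largePart; split_ifs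
  exacts [hu i, zero_mem_digits K]

-- At a position with moduli 2⁻ᵏ, 2⁻ˡ, 2⁻ⁿ only the term (k, l + n) of the double sum survives. Both
-- l and n are at most k, because u is smallest there, and at most s = l + n, so the truncation at
-- 2^{-min(k,s)} removes nothing inside the region. The range 2K accommodates l + n.
open Classical in
theorem region_entry (K : ℕ) (R₂ R₃ : ℝ → ℝ → Prop)
    (h₂ : ∀ x y, R₂ x y → x ≤ y) (h₃ : ∀ x y, R₃ x y → x ≤ y)
    (u : I → ℝ) (v : J → ℝ) (w : H → ℝ) (hu : ∀ i, u i ∈ digits K) (hv : ∀ i, v i ∈ digits K)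
    (hw : ∀ i, w i ∈ digits K) (p : I × J × H) :
    (if R₂ |u p.1| |v p.2.1| ∧ R₃ |u p.1| |w p.2.2| then u p.1 * v p.2.1 * w p.2.2 else 0) =
      ∑ k ∈ Finset.range (2 * K), ∑ s ∈ Finset.range (2 * K), (1 / 2 : ℝ) ^ k * (1 / 2) ^ s *
        signPattern (exactPart u k) (largePart R₂ v k s) (largePart R₃ w k s) s p := by
  obtain ⟨i, j, h⟩ := p
  simp only [signPattern]
  rcases mem_digits.1 (hu i) with hu0 | ⟨k, hk, hu0⟩
  · simp [exactPart, hu0]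
  rcases mem_digits.1 (hv j) with hv0 | ⟨l, hl, hv0⟩
  · simp [largePart, hv0]
  rcases mem_digits.1 (hw h) with hw0 | ⟨n, hn, hw0⟩
  · simp [largePart, hw0]
  have hvw : |v j * w h| = (1 / 2) ^ (l + n) := by rw [abs_mul, hv0, hw0, pow_add]
  rw [Finset.sum_eq_single_of_mem k (by simp; omega), Finset.sum_eq_single_of_mem (l + n)
    (by simp; omega)]
  · have hmin : (1 / 2 : ℝ) ^ (min k (l + n)) ≤ (1 / 2) ^ l ↔ l ≤ k := by
      rw [half_pow_le_iff]; omega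
    have hmin' : (1 / 2 : ℝ) ^ (min k (l + n)) ≤ (1 / 2) ^ n ↔ n ≤ k := by
      rw [half_pow_le_iff]; omega
    have i2 : R₂ ((1 / 2) ^ k) ((1 / 2) ^ l) → l ≤ k := fun hR => half_pow_le_iff.1 (h₂ _ _ hR)
    have i3 : R₃ ((1 / 2) ^ k) ((1 / 2) ^ n) → n ≤ k := fun hR => half_pow_le_iff.1 (h₃ _ _ hR)
    simp only [exactPart, largePart, level, hu0, hv0, hw0, hmin, hmin', if_true]
    by_cases c2 : R₂ ((1 / 2) ^ k) ((1 / 2) ^ l)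
    · by_cases c3 : R₃ ((1 / 2) ^ k) ((1 / 2) ^ n)
      · simp only [c2, c3, i2 c2, i3 c3, and_self, if_true, hvw, mul_one]
        conv_lhs => rw [← sign_mul_abs (u i), ← sign_mul_abs (v j), ← sign_mul_abs (w h),
          hu0, hv0, hw0]
        rw [pow_add]
        ring
      · simp only [c3, and_false, if_false, sign_zero, SignType.coe_zero, mul_zero, zero_mul]
    · simp only [c2, false_and, and_false, if_false, sign_zero, SignType.coe_zero, mul_zero,
        zero_mul]
  · intro s _ hs
    by_cases c2 : largePart R₂ v k s j = 0
    · simp [c2]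
    by_cases c3 : largePart R₃ w k s h = 0
    · simp [c3]
    have e2 : largePart R₂ v k s j = v j := by
      unfold largePart at c2 ⊢; split_ifs at c2 ⊢ <;> simp_all
    have e3 : largePart R₃ w k s h = w h := by
      unfold largePart at c3 ⊢; split_ifs at c3 ⊢ <;> simp_all
    rw [level, e2, e3, hvw, if_neg (fun h => hs (half_pow_inj h).symm)]
    simp
  · intro k' _ hk'
    have : exactPart u k' i = 0 := by
      rw [exactPart, hu0, if_neg (fun h => hk' (half_pow_inj h).symm)]
    simp [this]

end Level

/-! ### Summing the block bounds over all dyadic levels. -/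

variable {I J H : Type*} [Fintype I] [Fintype J] [Fintype H]

/-- The number of positions in a level. -/
noncomputable def levelCard (v : J → ℝ) (w : H → ℝ) (s : ℕ) : ℝ := ∑ q, level v w s q

/-- Control of the restrictions of `Y` to all dyadic blocks. -/
structure BlockBound (K m : ℕ) (κ τ θ E₀ : ℝ) (Y : I × J × H → ℝ) : Prop where
  sign_le : ∀ (u : I → ℝ) (v : J → ℝ) (w : H → ℝ), (∀ i, u i ∈ digits K) →
    (∀ i, v i ∈ digits K) → (∀ i, w i ∈ digits K) → ∀ s < m,
    |∑ p, signPattern u v w s p * Y p| ≤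
      κ * (2 * √(τ * (nnz u * levelCard v w s) * (E₀ + θ * (nnz u + nnz v + nnz w)))
        + 2 * (E₀ + θ * (nnz u + nnz v + nnz w)))
  mass_le : ∀ (v : J → ℝ) (w : H → ℝ), (∀ i, v i ∈ digits K) → (∀ i, w i ∈ digits K) →
    ∀ s < m, ∑ p, level v w s p.2 * |Y p| ≤
      κ * (3 * (τ * (Fintype.card I * levelCard v w s)) + 3 * (E₀ + θ * (nnz v + nnz w)))

theorem levelCard_nonneg (v : J → ℝ) (w : H → ℝ) (s : ℕ) : 0 ≤ levelCard v w s :=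
  Finset.sum_nonneg fun _ _ => level_nonneg _ _ _ _

/-- Here a, b, c are support sizes and g is the size of the level. The first conclusion splits
Bernstein's square root. The second removes a from the linear term, which matters when u is
supported on many tiny entries: there θ·a could not be summed. -/
theorem block_arith {τ θ E₀ N a b c g x κ : ℝ} (hτ : 0 ≤ τ) (hθ : 0 ≤ θ) (hE : 0 ≤ E₀)
    (ha : 0 ≤ a) (hb : 0 ≤ b) (hc : 0 ≤ c) (hg : 0 ≤ g) (hN : a ≤ N) (hκ : 0 ≤ κ)
    (h1 : x ≤ κ * (2 * √(τ * (a * g) * (E₀ + θ * (a + b + c))) + 2 * (E₀ + θ * (a + b + c)))) :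
    x ≤ κ * ((5 * √(θ * τ * N) + 2 * √(τ * E₀)) * √((a + b + c) * g)
        + 5 * (E₀ + θ * (a + b + c))) ∧
    (x ≤ κ * (3 * (τ * (N * g)) + 3 * (E₀ + θ * (b + c))) →
      x ≤ κ * ((5 * √(θ * τ * N) + 2 * √(τ * E₀)) * √((a + b + c) * g)
        + 5 * (E₀ + θ * (b + c)))) := by
  set t := a + b + c with ht
  have ht0 : 0 ≤ t := by positivity
  have hN0 : 0 ≤ N := ha.trans hN
  set y := τ * (N * g) with hy
  have hy0 : 0 ≤ y := by positivity
  have hz : √(θ * τ * N) * √(t * g) = √(θ * t) * √y := by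
    rw [← Real.sqrt_mul (by positivity), ← Real.sqrt_mul (by positivity), hy]
    congr 1; ring
  have hs : √(τ * (a * g) * (E₀ + θ * t)) ≤ √(θ * τ * N) * √(t * g) + √(τ * E₀) * √(t * g) := by
    have e1 : √(θ * τ * N) * √(t * g) = √(θ * τ * N * (t * g)) :=
      (Real.sqrt_mul (by positivity) _).symm
    have e2 : √(τ * E₀) * √(t * g) = √(τ * E₀ * (t * g)) :=
      (Real.sqrt_mul (by positivity) _).symm
    rw [e1, e2]
    have hadd {p q : ℝ} (hp : 0 ≤ p) (hq : 0 ≤ q) : √(p + q) ≤ √p + √q := by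
      refine Real.sqrt_le_iff.2 ⟨by positivity, ?_⟩
      nlinarith [Real.sq_sqrt hp, Real.sq_sqrt hq, Real.sqrt_nonneg p, Real.sqrt_nonneg q,
        mul_nonneg (Real.sqrt_nonneg p) (Real.sqrt_nonneg q)]
    refine (Real.sqrt_le_sqrt ?_).trans (hadd (by positivity) (by positivity))
    have hat : a ≤ t := by rw [ht]; linarith
    calc τ * (a * g) * (E₀ + θ * t) = θ * τ * a * (t * g) + τ * E₀ * (a * g) := by ring
      _ ≤ _ := by gcongr
  have hz0 : 0 ≤ √(θ * τ * N) * √(t * g) := by positivity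
  have hF : 0 ≤ E₀ + θ * t := by positivity
  refine ⟨h1.trans (mul_le_mul_of_nonneg_left ?_ hκ), fun h2 => ?_⟩
  · linarith
  · set A := √(θ * t) with hA
    set B := √y with hB
    have hA2 : A ^ 2 = θ * t := Real.sq_sqrt (by positivity)
    have hB2 : B ^ 2 = y := Real.sq_sqrt hy0
    have hA0 : 0 ≤ A := Real.sqrt_nonneg _
    have hB0 : 0 ≤ B := Real.sqrt_nonneg _
    have hbc : 0 ≤ θ * (b + c) := by positivity
    have hw0 : 0 ≤ √(τ * E₀) * √(t * g) := by positivity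
    have hsplit : (5 * √(θ * τ * N) + 2 * √(τ * E₀)) * √(t * g)
        = 5 * (A * B) + 2 * (√(τ * E₀) * √(t * g)) := by rw [← hz]; ring
    rw [hz] at hs hz0
    rw [hsplit]
    -- If θt ≤ τNg, the linear term θt of Bernstein is absorbed by the geometric mean AB. Otherwise
    -- the mass bound is used, and its term τNg is absorbed instead.
    rcases le_total A B with hAB | hAB
    · refine h1.trans (mul_le_mul_of_nonneg_left ?_ hκ)
      nlinarith
    · refine h2.trans (mul_le_mul_of_nonneg_left ?_ hκ)
      nlinarith

theorem sum_quarter_pow_eq_le (m : ℕ) (x : ℝ) :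
    ∑ k ∈ Finset.range m, (1 / 4 : ℝ) ^ k * (if |x| = (1 / 2) ^ k then 1 else 0) ≤ x ^ 2 := by
  by_cases h : ∃ l, |x| = (1 / 2 : ℝ) ^ l
  · obtain ⟨l, hl⟩ := h
    calc _ ≤ ∑ k ∈ Finset.range m, (if l = k then x ^ 2 else 0) := by
          refine Finset.sum_le_sum fun k _ => ?_
          by_cases h : l = k
          · subst h
            rw [if_pos hl, if_pos rfl, ← sq_abs, hl, ← pow_mul, mul_comm l, pow_mul]
            norm_num
          · rw [if_neg (fun h' => h (half_pow_inj (hl.symm.trans h'))), if_neg h, mul_zero]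
      _ ≤ _ := by
          rw [Finset.sum_ite_eq]
          split_ifs
          exacts [le_rfl, sq_nonneg x]
  · push Not at h
    simp only [h, if_false, mul_zero, Finset.sum_const_zero]
    exact sq_nonneg x

/-- The number of entries of modulus at least `2⁻ᵏ`. -/
noncomputable def largeCard {ι : Type*} [Fintype ι] (v : ι → ℝ) (k : ℕ) : ℝ :=
  ∑ j, if (1 / 2) ^ k ≤ |v j| then 1 else 0

theorem largeCard_nonneg {ι : Type*} [Fintype ι] (v : ι → ℝ) (k : ℕ) : 0 ≤ largeCard v k :=
  Finset.sum_nonneg fun _ _ => by split_ifs <;> norm_num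

theorem largeCard_mono {ι : Type*} [Fintype ι] (v : ι → ℝ) {k l : ℕ} (h : k ≤ l) :
    largeCard v k ≤ largeCard v l := by
  refine Finset.sum_le_sum fun j _ => ?_
  have := half_pow_le_iff.2 h
  by_cases h1 : (1 / 2 : ℝ) ^ k ≤ |v j|
  · rw [if_pos h1, if_pos (this.trans h1)]
  · rw [if_neg h1]; split_ifs <;> norm_num

theorem nnz_largePart_le {ι : Type*} [Fintype ι] (R : ℝ → ℝ → Prop) (v : ι → ℝ) (k s : ℕ) :
    nnz (largePart R v k s) ≤ largeCard v (min k s) := by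
  refine Finset.sum_le_sum fun j _ => ?_
  unfold largePart
  split_ifs <;> simp_all

theorem sum_largeCard_le {ι : Type*} [Fintype ι] (K m : ℕ) {v : ι → ℝ}
    (hv : ∀ i, v i ∈ digits K) :
    ∑ k ∈ Finset.range m, (1 / 4 : ℝ) ^ k * largeCard v k ≤ 2 * ∑ i, v i ^ 2 := by
  simp only [largeCard, Finset.mul_sum]
  rw [Finset.sum_comm]
  exact Finset.sum_le_sum fun i _ => sum_quarter_pow_le K m (hv i)

theorem sum_nnz_exactPart_le {ι : Type*} [Fintype ι] (m : ℕ) (u : ι → ℝ) :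
    ∑ k ∈ Finset.range m, (1 / 4 : ℝ) ^ k * nnz (exactPart u k) ≤ ∑ i, u i ^ 2 := by
  simp only [nnz, Finset.mul_sum]
  rw [Finset.sum_comm]
  refine Finset.sum_le_sum fun i _ => (Finset.sum_le_sum fun k _ => ?_).trans
    (sum_quarter_pow_eq_le m (u i))
  refine mul_le_mul_of_nonneg_left ?_ (by positivity)
  by_cases h : |u i| = (1 / 2) ^ k
  · rw [if_pos h]; split_ifs <;> norm_num
  · rw [exactPart, if_neg h, if_pos rfl, if_neg h]

theorem sum_levelCard_le (m : ℕ) (v : J → ℝ) (w : H → ℝ) :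
    ∑ s ∈ Finset.range m, (1 / 4 : ℝ) ^ s * levelCard v w s ≤
      (∑ i, v i ^ 2) * ∑ i, w i ^ 2 := by
  have h : (∑ i, v i ^ 2) * ∑ i, w i ^ 2 = ∑ q : J × H, (v q.1 * w q.2) ^ 2 := by
    rw [Finset.sum_mul_sum, Fintype.sum_prod_type]
    simp only [mul_pow]
  rw [h]
  simp only [levelCard, level, Finset.mul_sum]
  rw [Finset.sum_comm]
  exact Finset.sum_le_sum fun q _ => sum_quarter_pow_eq_le m _

theorem levelCard_largePart_le (R₂ R₃ : ℝ → ℝ → Prop) (v : J → ℝ) (w : H → ℝ) (k s : ℕ) :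
    levelCard (largePart R₂ v k s) (largePart R₃ w k s) s ≤ levelCard v w s := by
  refine Finset.sum_le_sum fun q _ => ?_
  have h0 : (0 : ℝ) ≠ (1 / 2) ^ s := by positivity
  have hnn : (0 : ℝ) ≤ if |v q.1 * w q.2| = (1 / 2) ^ s then 1 else 0 := by
    split_ifs <;> norm_num
  unfold level largePart
  by_cases h1 : (1 / 2) ^ min k s ≤ |v q.1| ∧ R₂ ((1 / 2) ^ k) |v q.1|
  · by_cases h2 : (1 / 2) ^ min k s ≤ |w q.2| ∧ R₃ ((1 / 2) ^ k) |w q.2|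
    · rw [if_pos h1, if_pos h2]
    · rw [if_neg h2, mul_zero, abs_zero, if_neg h0]
      exact hnn
  · rw [if_neg h1, zero_mul, abs_zero, if_neg h0]
    exact hnn

/-- The weighted support size of the dyadic level `k`. -/
noncomputable def levelWeight (u : I → ℝ) (v : J → ℝ) (w : H → ℝ) (k : ℕ) : ℝ :=
  (1 / 4) ^ k * (nnz (exactPart u k) + largeCard v k + largeCard w k)

theorem levelWeight_nonneg (u : I → ℝ) (v : J → ℝ) (w : H → ℝ) (k : ℕ) :
    0 ≤ levelWeight u v w k :=
  mul_nonneg (by positivity) (add_nonneg (add_nonneg (nnz_nonneg _) (largeCard_nonneg _ _))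
    (largeCard_nonneg _ _))

theorem sum_levelWeight_le (K m : ℕ) {u : I → ℝ} {v : J → ℝ} {w : H → ℝ}
    (hv : ∀ i, v i ∈ digits K) (hw : ∀ i, w i ∈ digits K)
    (hu1 : ∑ i, u i ^ 2 ≤ 1) (hv1 : ∑ i, v i ^ 2 ≤ 1) (hw1 : ∑ i, w i ^ 2 ≤ 1) :
    ∑ k ∈ Finset.range m, levelWeight u v w k ≤ 5 := by
  simp only [levelWeight, mul_add, Finset.sum_add_distrib]
  have h1 := sum_nnz_exactPart_le m u
  have h2 := sum_largeCard_le K m hv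
  have h3 := sum_largeCard_le K m hw
  linarith

/-- For k ≤ s the weight is 2⁻ᵏ⁻ˢ = 2^{-(s-k)}·4⁻ᵏ, and 4⁻ᵏ pays for all three supports. For s < k
only 2^{-(k-s)}·4⁻ˢ is available; it pays for v and w truncated at 2⁻ˢ but not for the support of u,
hence the second half of `block_arith`. -/
theorem abs_block_le {K m : ℕ} {κ τ θ E₀ : ℝ} (hκ : 0 ≤ κ) (hτ : 0 ≤ τ) (hθ : 0 ≤ θ) (hE : 0 ≤ E₀)
    {Y : I × J × H → ℝ} (hY : BlockBound K m κ τ θ E₀ Y) (R₂ R₃ : ℝ → ℝ → Prop)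
    {u : I → ℝ} {v : J → ℝ} {w : H → ℝ} (hu : ∀ i, u i ∈ digits K) (hv : ∀ i, v i ∈ digits K)
    (hw : ∀ i, w i ∈ digits K) {k s : ℕ} (hs : s < m) :
    (1 / 2) ^ k * (1 / 2) ^ s *
      |∑ p, signPattern (exactPart u k) (largePart R₂ v k s) (largePart R₃ w k s) s p * Y p| ≤
    κ * ((5 * √(θ * τ * Fintype.card I) + 2 * √(τ * E₀)) *
        (√(levelWeight u v w k) * √((1 / 4) ^ s * levelCard v w s)) +
      5 * ((if k ≤ s then (1 / 2) ^ (s - k) * ((1 / 4) ^ k * E₀ + θ * levelWeight u v w k) else 0)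
        + if s ≤ k then (1 / 2) ^ (k - s) * ((1 / 4) ^ s * E₀ + θ * levelWeight u v w s)
          else 0)) := by
  set a := nnz (exactPart u k)
  set b := nnz (largePart R₂ v k s)
  set c := nnz (largePart R₃ w k s)
  set g := levelCard (largePart R₂ v k s) (largePart R₃ w k s) s
  set x := |∑ p, signPattern (exactPart u k) (largePart R₂ v k s) (largePart R₃ w k s) s p * Y p|
    with hx
  have ha : 0 ≤ a := nnz_nonneg _
  have hb : 0 ≤ b := nnz_nonneg _
  have hc : 0 ≤ c := nnz_nonneg _
  have hg : 0 ≤ g := levelCard_nonneg _ _ _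
  have h1 : x ≤ _ := hY.sign_le _ _ _ (exactPart_mem hu k) (largePart_mem hv R₂ k s)
    (largePart_mem hw R₃ k s) s hs
  have h2 : x ≤ κ * (3 * (τ * (Fintype.card I * g)) + 3 * (E₀ + θ * (b + c))) := by
    refine le_trans ?_ (hY.mass_le _ _ (largePart_mem hv R₂ k s) (largePart_mem hw R₃ k s) s hs)
    refine (Finset.abs_sum_le_sum_abs _ _).trans (Finset.sum_le_sum fun p _ => ?_)
    rw [abs_mul]
    refine mul_le_mul_of_nonneg_right ((abs_signPattern_le _ _ _ _ _).trans ?_) (abs_nonneg _)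
    exact mul_le_of_le_one_left (level_nonneg _ _ _ _) (by split_ifs <;> norm_num)
  obtain ⟨hA, hB⟩ := block_arith hτ hθ hE ha hb hc hg (nnz_le_card (exactPart u k)) hκ h1
  have hB := hB h2
  set C := 5 * √(θ * τ * Fintype.card I) + 2 * √(τ * E₀) with hC
  have hC0 : 0 ≤ C := by positivity
  have hbV : b ≤ largeCard v (min k s) := nnz_largePart_le _ _ _ _
  have hcV : c ≤ largeCard w (min k s) := nnz_largePart_le _ _ _ _
  have hp (n : ℕ) : (1 / 4 : ℝ) ^ n = (1 / 2) ^ n * (1 / 2) ^ n := by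
    rw [← mul_pow]; norm_num
  have hk0 : (0 : ℝ) < (1 / 2) ^ k := by positivity
  have hs0 : (0 : ℝ) < (1 / 2) ^ s := by positivity
  have habc : a + b + c ≤ a + largeCard v k + largeCard w k := by
    have := largeCard_mono v (min_le_left k s)
    have := largeCard_mono w (min_le_left k s)
    linarith
  have hroot : (1 / 2) ^ k * (1 / 2) ^ s * √((a + b + c) * g) ≤
      √(levelWeight u v w k) * √((1 / 4) ^ s * levelCard v w s) := by
    rw [← Real.sqrt_mul (levelWeight_nonneg u v w k)]
    refine Real.le_sqrt_of_sq_le ?_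
    rw [mul_pow, Real.sq_sqrt (by positivity), levelWeight, hp, hp]
    calc ((1 / 2 : ℝ) ^ k * (1 / 2) ^ s) ^ 2 * ((a + b + c) * g)
        ≤ ((1 / 2 : ℝ) ^ k * (1 / 2) ^ s) ^ 2 * ((a + largeCard v k + largeCard w k)
          * levelCard v w s) := by
          have := levelCard_largePart_le R₂ R₃ v w k s
          have : 0 ≤ a + largeCard v k + largeCard w k := by linarith
          gcongr
      _ = _ := by ring
  have hnn1 : 0 ≤ if k ≤ s then (1 / 2) ^ (s - k) *
      ((1 / 4) ^ k * E₀ + θ * levelWeight u v w k) else 0 := by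
    have := levelWeight_nonneg u v w k
    split_ifs <;> positivity
  have hnn2 : 0 ≤ if s ≤ k then (1 / 2) ^ (k - s) *
      ((1 / 4) ^ s * E₀ + θ * levelWeight u v w s) else 0 := by
    have := levelWeight_nonneg u v w s
    split_ifs <;> positivity
  have fin (F : ℝ) (hF : x ≤ κ * (C * √((a + b + c) * g) + 5 * F))
      (hF' : (1 / 2) ^ k * (1 / 2) ^ s * F ≤
        (if k ≤ s then (1 / 2) ^ (s - k) * ((1 / 4) ^ k * E₀ + θ * levelWeight u v w k) else 0)
        + if s ≤ k then (1 / 2) ^ (k - s) * ((1 / 4) ^ s * E₀ + θ * levelWeight u v w s) else 0) :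
      (1 / 2) ^ k * (1 / 2) ^ s * x ≤ κ * (C * (√(levelWeight u v w k) *
        √((1 / 4) ^ s * levelCard v w s)) + 5 * ((if k ≤ s then (1 / 2) ^ (s - k) *
        ((1 / 4) ^ k * E₀ + θ * levelWeight u v w k) else 0) + if s ≤ k then (1 / 2) ^ (k - s) *
        ((1 / 4) ^ s * E₀ + θ * levelWeight u v w s) else 0)) := by
    calc (1 / 2) ^ k * (1 / 2) ^ s * x
        ≤ (1 / 2) ^ k * (1 / 2) ^ s * (κ * (C * √((a + b + c) * g) + 5 * F)) := by gcongr
      _ = κ * (C * ((1 / 2) ^ k * (1 / 2) ^ s * √((a + b + c) * g)) +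
          5 * ((1 / 2) ^ k * (1 / 2) ^ s * F)) := by ring
      _ ≤ _ := by gcongr
  by_cases hks : k ≤ s
  · refine fin _ hA ((le_of_eq_of_le (b := (1 / 2) ^ (s - k) * ((1 / 4) ^ k *
      (E₀ + θ * (a + b + c)))) ?_ ?_).trans (le_add_of_nonneg_right hnn2))
    · obtain ⟨j, rfl⟩ := Nat.exists_eq_add_of_le hks
      rw [Nat.add_sub_cancel_left, hp, pow_add]
      ring
    · rw [if_pos hks]
      refine mul_le_mul_of_nonneg_left ?_ (by positivity)
      rw [levelWeight]
      calc (1 / 4) ^ k * (E₀ + θ * (a + b + c))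
          ≤ (1 / 4) ^ k * (E₀ + θ * (a + largeCard v k + largeCard w k)) := by gcongr
        _ = _ := by ring
  · have hsk : s ≤ k := by omega
    refine fin _ hB ((le_of_eq_of_le (b := (1 / 2) ^ (k - s) * ((1 / 4) ^ s *
      (E₀ + θ * (b + c)))) ?_ ?_).trans (le_add_of_nonneg_left hnn1))
    · obtain ⟨j, rfl⟩ := Nat.exists_eq_add_of_le hsk
      rw [Nat.add_sub_cancel_left, hp, pow_add]
      ring
    · rw [if_pos hsk]
      refine mul_le_mul_of_nonneg_left ?_ (by positivity)
      rw [levelWeight]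
      rw [min_eq_right hsk] at hbV hcV
      have := nnz_nonneg (exactPart u s)
      calc (1 / 4) ^ s * (E₀ + θ * (b + c))
          ≤ (1 / 4) ^ s * (E₀ + θ * (nnz (exactPart u s) + largeCard v s + largeCard w s)) := by
            gcongr
            linarith
        _ = _ := by ring

theorem sum_sqrt_le (m : ℕ) (f : ℕ → ℝ) (hf : ∀ k, 0 ≤ f k) {B : ℝ}
    (h : ∑ k ∈ Finset.range m, f k ≤ B) : ∑ k ∈ Finset.range m, √(f k) ≤ √(m * B) := by
  refine Real.le_sqrt_of_sq_le (sq_sum_le_card_mul_sum_sq.trans ?_)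
  rw [Finset.card_range]
  refine mul_le_mul_of_nonneg_left ?_ (by positivity)
  simpa only [Real.sq_sqrt (hf _)] using h

/-- Off-diagonal decay: summing both geometric kernels costs only a constant, with no factor for the
number of levels. -/
theorem sum_convolution_le (m : ℕ) (e : ℕ → ℝ) (he : ∀ k, 0 ≤ e k) :
    ∑ k ∈ Finset.range m, ∑ s ∈ Finset.range m, ((if k ≤ s then (1 / 2) ^ (s - k) * e k else 0)
      + if s ≤ k then (1 / 2) ^ (k - s) * e s else 0) ≤ 4 * ∑ k ∈ Finset.range m, e k := by
  have h : ∑ k ∈ Finset.range m, ∑ s ∈ Finset.range m,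
      (if k ≤ s then (1 / 2) ^ (s - k) * e k else 0) ≤ 2 * ∑ k ∈ Finset.range m, e k := by
    rw [Finset.mul_sum]
    refine Finset.sum_le_sum fun k _ => ?_
    have := mul_le_mul_of_nonneg_right (sum_geometric_from m k) (he k)
    simpa only [Finset.sum_mul, ite_mul, zero_mul] using this
  simp only [Finset.sum_add_distrib]
  rw [Finset.sum_comm (f := fun k s => if s ≤ k then (1 / 2) ^ (k - s) * e s else 0)]
  linarith

open Classical in
theorem abs_region_le {K : ℕ} {κ τ θ E₀ : ℝ} (hκ : 0 ≤ κ) (hτ : 0 ≤ τ) (hθ : 0 ≤ θ) (hE : 0 ≤ E₀)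
    {Y : I × J × H → ℝ} (hY : BlockBound K (2 * K) κ τ θ E₀ Y) {R₂ R₃ : ℝ → ℝ → Prop}
    (h₂ : ∀ x y, R₂ x y → x ≤ y) (h₃ : ∀ x y, R₃ x y → x ≤ y)
    {u : I → ℝ} {v : J → ℝ} {w : H → ℝ} (hu : ∀ i, u i ∈ digits K) (hv : ∀ i, v i ∈ digits K)
    (hw : ∀ i, w i ∈ digits K)
    (hu1 : ∑ i, u i ^ 2 ≤ 1) (hv1 : ∑ i, v i ^ 2 ≤ 1) (hw1 : ∑ i, w i ^ 2 ≤ 1) :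
    |∑ p : I × J × H, (if R₂ |u p.1| |v p.2.1| ∧ R₃ |u p.1| |w p.2.2| then
      u p.1 * v p.2.1 * w p.2.2 else 0) * Y p| ≤
    κ * (6 * K * (5 * √(θ * τ * Fintype.card I) + 2 * √(τ * E₀)) + 40 * E₀ + 100 * θ) := by
  set C := 5 * √(θ * τ * Fintype.card I) + 2 * √(τ * E₀) with hC
  have hC0 : 0 ≤ C := by positivity
  set e : ℕ → ℝ := fun k => (1 / 4) ^ k * E₀ + θ * levelWeight u v w k with he
  have he0 (k : ℕ) : 0 ≤ e k := by
    have := levelWeight_nonneg u v w k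
    simp only [he]; positivity
  have hP := sum_levelWeight_le K (2 * K) hv hw hu1 hv1 hw1
  have hρ : ∑ s ∈ Finset.range (2 * K), (1 / 4 : ℝ) ^ s * levelCard v w s ≤ 1 :=
    (sum_levelCard_le _ v w).trans (mul_le_one₀ hv1 (by positivity) hw1)
  -- The square root terms factor into a function of k times a function of s. Cauchy–Schwarz over 2K
  -- levels gives √(2K·5)·√(2K·1) ≤ 6K.
  have hroots : (∑ k ∈ Finset.range (2 * K), √(levelWeight u v w k)) *
      (∑ s ∈ Finset.range (2 * K), √((1 / 4) ^ s * levelCard v w s)) ≤ 6 * K := by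
    calc _ ≤ √((2 * K : ℕ) * 5) * √((2 * K : ℕ) * 1) := by
          gcongr
          · exact sum_sqrt_le _ _ (levelWeight_nonneg u v w) hP
          · exact sum_sqrt_le _ _ (fun s => mul_nonneg (by positivity) (levelCard_nonneg v w s)) hρ
      _ ≤ _ := by
        rw [← Real.sqrt_mul (by positivity)]
        refine Real.sqrt_le_iff.2 ⟨by positivity, ?_⟩
        push_cast
        nlinarith [sq_nonneg (K : ℝ)]
  have hesum : ∑ k ∈ Finset.range (2 * K), e k ≤ 2 * E₀ + 5 * θ := by
    simp only [he, Finset.sum_add_distrib, ← Finset.sum_mul, ← Finset.mul_sum]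
    have : ∑ k ∈ Finset.range (2 * K), (1 / 4 : ℝ) ^ k ≤ 2 := by
      refine (Finset.sum_le_sum fun k _ => ?_).trans (sum_geometric_two_le (2 * K))
      gcongr; norm_num
    nlinarith
  have hexp : ∑ p : I × J × H, (if R₂ |u p.1| |v p.2.1| ∧ R₃ |u p.1| |w p.2.2| then
      u p.1 * v p.2.1 * w p.2.2 else 0) * Y p
      = ∑ k ∈ Finset.range (2 * K), ∑ s ∈ Finset.range (2 * K), (1 / 2) ^ k * (1 / 2) ^ s *
      ∑ p, signPattern (exactPart u k) (largePart R₂ v k s) (largePart R₃ w k s) s p * Y p := by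
    simp only [region_entry K R₂ R₃ h₂ h₃ u v w hu hv hw]
    simp only [Finset.sum_mul, Finset.mul_sum, mul_assoc]
    rw [Finset.sum_comm]
    refine Finset.sum_congr rfl fun k _ => ?_
    rw [Finset.sum_comm]
  rw [hexp]
  calc _ ≤ ∑ k ∈ Finset.range (2 * K), ∑ s ∈ Finset.range (2 * K),
      κ * (C * (√(levelWeight u v w k) * √((1 / 4) ^ s * levelCard v w s)) +
        5 * ((if k ≤ s then (1 / 2) ^ (s - k) * e k else 0)
          + if s ≤ k then (1 / 2) ^ (k - s) * e s else 0)) := by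
        refine (Finset.abs_sum_le_sum_abs _ _).trans (Finset.sum_le_sum fun k _ => ?_)
        refine (Finset.abs_sum_le_sum_abs _ _).trans (Finset.sum_le_sum fun s hs => ?_)
        rw [abs_mul, abs_of_pos (by positivity)]
        exact abs_block_le hκ hτ hθ hE hY R₂ R₃ hu hv hw (Finset.mem_range.1 hs)
    _ = κ * (C * ((∑ k ∈ Finset.range (2 * K), √(levelWeight u v w k)) *
        (∑ s ∈ Finset.range (2 * K), √((1 / 4) ^ s * levelCard v w s))) +
        5 * ∑ k ∈ Finset.range (2 * K), ∑ s ∈ Finset.range (2 * K),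
          ((if k ≤ s then (1 / 2) ^ (s - k) * e k else 0)
          + if s ≤ k then (1 / 2) ^ (k - s) * e s else 0)) := by
        rw [Finset.sum_mul_sum]
        simp only [Finset.mul_sum, ← Finset.sum_add_distrib, mul_add]
    _ ≤ κ * (C * (6 * K) + 5 * (4 * ∑ k ∈ Finset.range (2 * K), e k)) := by
        gcongr
        exact sum_convolution_le _ e he0
    _ ≤ _ := by
        refine mul_le_mul_of_nonneg_left ?_ hκ
        linarith

/-! ### Bernstein's inequality for uniform sampling. -/

section Bernstein

variable {α : Type*} [Fintype α] [MeasurableSpace α] [MeasurableSingletonClass α]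
  {Ω : Type*} [MeasurableSpace Ω] {P : Measure Ω} {n : ℕ} {ω : Fin n → Ω → α}

theorem integral_comp_uniform [Nonempty α] {X : Ω → α} (hm : Measurable X)
    (hu : P.map X = uniformOn Set.univ) (f : α → ℝ) :
    ∫ o, f (X o) ∂P = (∑ a, f a) / Fintype.card α := by
  have hf : Measurable f := measurable_of_finite f
  rw [← integral_map (f := f) hm.aemeasurable hf.aestronglyMeasurable, hu]
  have hsing (a : α) : (uniformOn (Set.univ : Set α)).real {a} = 1 / Fintype.card α := by
    rw [measureReal_def, uniformOn_univ]
    simp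
  have : IsProbabilityMeasure (uniformOn (Set.univ : Set α)) :=
    isProbabilityMeasure_uniformOn Set.finite_univ Set.univ_nonempty
  rw [integral_fintype (Integrable.of_finite)]
  simp only [hsing, smul_eq_mul]
  rw [← Finset.mul_sum]
  ring

theorem exp_le_one_add_add_sq {x : ℝ} (hx : |x| ≤ 1) : Real.exp x ≤ 1 + x + x ^ 2 := by
  have := (abs_le.1 (Real.abs_exp_sub_one_sub_id_le hx)).2
  linarith

variable [Nonempty α] [IsProbabilityMeasure P]

/-- One-sided Bernstein inequality for uniform sampling with replacement. -/
theorem bernstein_upper (hm : ∀ i, Measurable (ω i)) (hind : iIndepFun ω P)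
    (hu : ∀ i, P.map (ω i) = uniformOn Set.univ) (f : α → ℝ) (hf : ∀ a, |f a| ≤ 1)
    {V : ℝ} (hV : n * (∑ a, f a ^ 2) / Fintype.card α ≤ V) {t : ℝ} (ht : 0 < t) :
    P.real {o | n * (∑ a, f a) / Fintype.card α + (2 * √(V * t) + 2 * t) ≤ ∑ i, f (ω i o)}
      ≤ Real.exp (-t) := by
  have hV0 : 0 ≤ V := le_trans (by positivity) hV
  set μ := n * (∑ a, f a) / Fintype.card α with hμ
  have hbound (x : ℝ) (hx0 : 0 ≤ x) (hx1 : x ≤ 1) (ε : ℝ) :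
      P.real {o | ε ≤ ∑ i, f (ω i o)} ≤ Real.exp (-x * ε + (x * μ + x ^ 2 * V)) := by
    have hfm : Measurable f := measurable_of_finite f
    have hmgf (i : Fin n) : mgf (fun o => f (ω i o)) P x ≤
        Real.exp (x * ((∑ a, f a) / Fintype.card α) +
          x ^ 2 * ((∑ a, f a ^ 2) / Fintype.card α)) := by
      rw [mgf, integral_comp_uniform (hm i) (hu i) (fun a => Real.exp (x * f a))]
      have hc : (0 : ℝ) < Fintype.card α := by exact_mod_cast Fintype.card_pos
      calc (∑ a, Real.exp (x * f a)) / Fintype.card α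
          ≤ (∑ a, (1 + x * f a + x ^ 2 * f a ^ 2)) / Fintype.card α := by
            gcongr with a
            rw [← mul_pow]
            refine exp_le_one_add_add_sq ?_
            rw [abs_mul, abs_of_nonneg hx0]
            exact mul_le_one₀ hx1 (abs_nonneg _) (hf a)
        _ = (x * ((∑ a, f a) / Fintype.card α) +
          x ^ 2 * ((∑ a, f a ^ 2) / Fintype.card α)) + 1 := by
            simp only [Finset.sum_add_distrib, ← Finset.mul_sum]
            simp
            field_simp
            ring
        _ ≤ _ := Real.add_one_le_exp _
    have hind' : iIndepFun (fun i o => f (ω i o)) P :=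
      hind.comp (fun _ => f) (fun _ => hfm)
    have hsum : mgf (∑ i, fun o => f (ω i o)) P x ≤ Real.exp (x * μ + x ^ 2 * V) := by
      rw [hind'.mgf_sum (fun i => hfm.comp (hm i))]
      calc _ ≤ ∏ _i : Fin n, Real.exp (x * ((∑ a, f a) / Fintype.card α) +
          x ^ 2 * ((∑ a, f a ^ 2) / Fintype.card α)) :=
            Finset.prod_le_prod (fun i _ => mgf_nonneg) fun i _ => hmgf i
        _ = Real.exp (x * μ + x ^ 2 * (n * (∑ a, f a ^ 2) / Fintype.card α)) := by
            rw [Finset.prod_const, ← Real.exp_nat_mul, Finset.card_univ, Fintype.card_fin]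
            congr 1
            rw [hμ]; ring
        _ ≤ _ := by gcongr
    have hint : Integrable (fun o => Real.exp (x * (∑ i, fun o => f (ω i o)) o)) P := by
      refine Integrable.of_bound (C := Real.exp (x * n)) ?_ (ae_of_all _ fun o => ?_)
      · refine (Measurable.exp (Measurable.const_mul ?_ x)).aestronglyMeasurable
        rw [show (∑ i, fun o => f (ω i o)) = fun o => ∑ i, f (ω i o) by ext o; simp]
        exact Finset.measurable_sum _ fun i _ => hfm.comp (hm i)
      · rw [Real.norm_eq_abs, Real.abs_exp]
        gcongr
        rw [Finset.sum_apply]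
        refine (Finset.sum_le_sum fun i _ => (abs_le.1 (hf (ω i o))).2).trans ?_
        simp
    have := measure_ge_le_exp_mul_mgf (μ := P) ε hx0 hint
    simp only [Finset.sum_apply] at this
    refine this.trans ?_
    rw [Real.exp_add]
    gcongr
  -- The exponent x = √(t/V) is admissible only if it is at most 1, the range of the quadratic bound
  -- on exp. Otherwise V < t and x = 1 is enough.
  by_cases hVt : t ≤ V
  · have hVpos : 0 < V := ht.trans_le hVt
    set x := √(t / V) with hx
    have hx2 : x ^ 2 = t / V := Real.sq_sqrt (by positivity)
    have hxV : x * √(V * t) = t := by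
      rw [hx, ← Real.sqrt_mul (by positivity)]
      rw [show t / V * (V * t) = t ^ 2 by field_simp]
      exact Real.sqrt_sq ht.le
    have hx0 : 0 ≤ x := Real.sqrt_nonneg _
    refine (hbound x hx0 (Real.sqrt_le_one.2 ((div_le_one hVpos).2 hVt)) _).trans ?_
    refine Real.exp_le_exp.2 ?_
    have : x ^ 2 * V = t := by rw [hx2]; field_simp
    nlinarith [mul_nonneg hx0 ht.le]
  · refine (hbound 1 zero_le_one le_rfl _).trans (Real.exp_le_exp.2 ?_)
    push Not at hVt
    have := Real.sqrt_nonneg (V * t)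
    linarith

/-- Bernstein's inequality for uniform sampling with replacement. -/
theorem bernstein (hm : ∀ i, Measurable (ω i)) (hind : iIndepFun ω P)
    (hu : ∀ i, P.map (ω i) = uniformOn Set.univ) (f : α → ℝ) (hf : ∀ a, |f a| ≤ 1)
    {V : ℝ} (hV : n * (∑ a, f a ^ 2) / Fintype.card α ≤ V) {t : ℝ} (ht : 0 < t) :
    P.real {o | ¬ |∑ i, f (ω i o) - n * (∑ a, f a) / Fintype.card α| ≤ 2 * √(V * t) + 2 * t}
      ≤ 2 * Real.exp (-t) := by
  have h1 := bernstein_upper hm hind hu f hf hV ht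
  have h2 := bernstein_upper hm hind hu (fun a => -f a) (by simpa using hf) (V := V)
    (by simpa using hV) ht
  refine (measureReal_mono ?_).trans ((measureReal_union_le _ _).trans (add_le_add h1 h2 |>.trans
    (by linarith)))
  intro o ho
  simp only [Set.mem_ofPred_eq, not_le, lt_abs, Set.mem_union, Finset.sum_neg_distrib, mul_neg,
    neg_div] at ho ⊢
  rcases ho with ho | ho
  · left; linarith
  · right; linarith

end Bernstein

/-! ### Union bound over all digit vectors, priced by support size. -/

/-- The digit vectors. -/
noncomputable def digitVecs (ι : Type*) [Fintype ι] [DecidableEq ι] (K : ℕ) : Finset (ι → ℝ) :=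
  Fintype.piFinset fun _ => digits K

/-- The sum factors over coordinates: each contributes 1 for the digit 0 and at most 2K·e^{-θ} for
all the others together. -/
theorem sum_exp_nnz_le {ι : Type*} [Fintype ι] [DecidableEq ι] (K : ℕ) {θ : ℝ}
    (h : Fintype.card ι * (2 * K * Real.exp (-θ)) ≤ 1) :
    ∑ u ∈ digitVecs ι K, Real.exp (-(θ * nnz u)) ≤ Real.exp 1 := by
  have h1 (u : ι → ℝ) : Real.exp (-(θ * nnz u)) =
      ∏ i, (if u i = 0 then 1 else Real.exp (-θ)) := by
    rw [nnz, Finset.mul_sum, ← Finset.sum_neg_distrib, Real.exp_sum]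
    refine Finset.prod_congr rfl fun i _ => ?_
    split_ifs <;> simp
  simp only [h1]
  rw [digitVecs, ← Finset.prod_univ_sum (fun _ : ι => digits K)
    (fun _ x => if x = 0 then (1 : ℝ) else Real.exp (-θ))]
  have h2 : ∑ x ∈ digits K, (if x = 0 then (1 : ℝ) else Real.exp (-θ)) ≤
      Real.exp (2 * K * Real.exp (-θ)) := by
    rw [← Finset.add_sum_erase _ _ (zero_mem_digits K), if_pos rfl]
    refine le_trans ?_ (Real.add_one_le_exp _)
    rw [add_comm]
    gcongr
    calc _ = ∑ x ∈ (digits K).erase 0, Real.exp (-θ) :=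
          Finset.sum_congr rfl fun x hx => if_neg (Finset.ne_of_mem_erase hx)
      _ ≤ _ := by
        rw [Finset.sum_const, nsmul_eq_mul]
        gcongr
        exact_mod_cast card_digits_erase K
  refine (Finset.prod_le_prod (fun i _ => ?_) fun i _ => h2).trans ?_
  · exact Finset.sum_nonneg fun x _ => by split_ifs <;> positivity
  · rw [Finset.prod_const, ← Real.exp_nat_mul, Finset.card_univ]
    exact Real.exp_le_exp.2 h

/-- The sampled deviation `X (1 - (D / n) N)`, where `N` counts the samples at each position. -/
noncomputable def deviation {α : Type*} [Fintype α] [DecidableEq α] {n : ℕ} (ω : Fin n → α)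
    (X : α → ℝ) (a : α) : ℝ :=
  X a - (Fintype.card α / n : ℝ) * ∑ i, if ω i = a then X a else 0

theorem sum_mul_deviation {α : Type*} [Fintype α] [DecidableEq α] {n : ℕ} (ω : Fin n → α)
    (X φ : α → ℝ) :
    ∑ a, φ a * deviation ω X a =
      ∑ a, φ a * X a - (Fintype.card α / n : ℝ) * ∑ i, φ (ω i) * X (ω i) := by
  simp only [deviation, mul_sub, Finset.sum_sub_distrib]
  congr 1
  simp only [Finset.mul_sum]
  rw [Finset.sum_comm]
  refine Finset.sum_congr rfl fun i _ => ?_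
  rw [Finset.sum_eq_single (ω i)]
  · simp; ring
  · intro b _ hb
    rw [if_neg hb.symm]; simp
  · simp

section Sampling

theorem sum_level_eq (v : J → ℝ) (w : H → ℝ) (s : ℕ) :
    ∑ p : I × J × H, level v w s p.2 = Fintype.card I * levelCard v w s := by
  rw [Fintype.sum_prod_type]
  simp [levelCard]

theorem sum_signPattern_sq_le (u : I → ℝ) (v : J → ℝ) (w : H → ℝ) (s : ℕ) :
    ∑ p, signPattern u v w s p ^ 2 ≤ nnz u * levelCard v w s := by
  have e : nnz u * levelCard v w s =
      ∑ p : I × J × H, (if u p.1 = 0 then 0 else 1) * level v w s p.2 := by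
    rw [nnz, levelCard, Finset.sum_mul_sum, Fintype.sum_prod_type]
  rw [e]
  refine Finset.sum_le_sum fun p _ => ?_
  have h := abs_signPattern_le u v w s p
  have h1 : (if u p.1 = 0 then 0 else 1) * level v w s p.2 ≤ 1 := by
    refine mul_le_one₀ (by split_ifs <;> norm_num) (level_nonneg _ _ _ _) (level_le_one _ _ _ _)
  rw [← sq_abs, sq]
  exact (mul_le_of_le_one_left (abs_nonneg _) (h.trans h1)).trans h

variable [DecidableEq I] [DecidableEq J] [DecidableEq H]

/-- The block bounds hold as soon as the empirical sums of all sign patterns and of all levels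
satisfy Bernstein's bound. -/
theorem blockBound_of_deviation {α : Type*} [Fintype α] [DecidableEq α] (e : α ≃ I × J × H)
    {n K m : ℕ} (hn : 0 < n) {M θ E₀ : ℝ} (hM : 0 < M) (hθ : 0 ≤ θ) (hE : 0 ≤ E₀) (X : α → ℝ)
    (hX : ∀ a, |X a| ≤ M) (ω : Fin n → α)
    (h1 : ∀ u ∈ digitVecs I K, ∀ v ∈ digitVecs J K, ∀ w ∈ digitVecs H K, ∀ s ∈ Finset.range m,
      |∑ i, signPattern u v w s (e (ω i)) * (X (ω i) / M) -
        n * (∑ a, signPattern u v w s (e a) * (X a / M)) / Fintype.card α| ≤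
        2 * √(n / Fintype.card α * (nnz u * levelCard v w s) *
          (E₀ + θ * (nnz u + nnz v + nnz w))) + 2 * (E₀ + θ * (nnz u + nnz v + nnz w)))
    (h2 : ∀ v ∈ digitVecs J K, ∀ w ∈ digitVecs H K, ∀ s ∈ Finset.range m,
      |∑ i, level v w s (e (ω i)).2 - n * (∑ a, level v w s (e a).2) / Fintype.card α| ≤
        2 * √(n / Fintype.card α * (Fintype.card I * levelCard v w s) *
          (E₀ + θ * (nnz v + nnz w))) + 2 * (E₀ + θ * (nnz v + nnz w))) :
    BlockBound K m (M * Fintype.card α / n) (n / Fintype.card α) θ E₀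
      (fun p => deviation ω X (e.symm p)) := by
  have hn0 : (0 : ℝ) < n := by exact_mod_cast hn
  have : Nonempty α := ⟨ω ⟨0, hn⟩⟩
  have hD : (0 : ℝ) < Fintype.card α := by exact_mod_cast Fintype.card_pos
  set D : ℝ := (Fintype.card α : ℝ) with hDdef
  refine ⟨fun u v w hu hv hw s hs => ?_, fun v w hv hw s hs => ?_⟩
  · have := h1 u (Fintype.mem_piFinset.2 hu) v (Fintype.mem_piFinset.2 hv) w
      (Fintype.mem_piFinset.2 hw) s (Finset.mem_range.2 hs)
    have hsum : ∑ p, signPattern u v w s p * deviation ω X (e.symm p) =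
        -(M * D / n) * (∑ i, signPattern u v w s (e (ω i)) * (X (ω i) / M) -
        n * (∑ a, signPattern u v w s (e a) * (X a / M)) / D) := by
      rw [← Equiv.sum_comp e]
      simp only [Equiv.symm_apply_apply]
      rw [sum_mul_deviation ω X (fun a => signPattern u v w s (e a))]
      simp only [← mul_div_assoc, ← Finset.sum_div]
      field_simp
      ring
    rw [hsum, abs_mul, abs_neg, abs_of_pos (by positivity)]
    exact mul_le_mul_of_nonneg_left this (by positivity)
  · have := h2 v (Fintype.mem_piFinset.2 hv) w
      (Fintype.mem_piFinset.2 hw) s (Finset.mem_range.2 hs)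
    have hlev : ∑ a, level v w s (e a).2 = Fintype.card I * levelCard v w s := by
      rw [← sum_level_eq, ← Equiv.sum_comp e]
    rw [hlev] at this
    set t := E₀ + θ * (nnz v + nnz w) with ht
    have ht0 : 0 ≤ t := by
      have := nnz_nonneg v
      have := nnz_nonneg w
      positivity
    set g := Fintype.card I * levelCard v w s with hg
    have hg0 : 0 ≤ g := by
      have := levelCard_nonneg v w s
      positivity
    -- AM–GM turns Bernstein's bound into a count of at most 2y + 3t samples in the level, with y =
    -- (n/D)·g.
    have hyt : 2 * √(n / D * g * t) ≤ n / D * g + t := by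
      have hy : 0 ≤ n / D * g := by positivity
      rw [Real.sqrt_mul hy]
      nlinarith [sq_nonneg (√(n / D * g) - √t), Real.sq_sqrt hy, Real.sq_sqrt ht0]
    have hN : ∑ i, level v w s (e (ω i)).2 ≤ 2 * (n / D * g) + 3 * t := by
      have := (abs_le.1 this).2
      have e1 : n * g / D = n / D * g := by ring
      linarith
    -- Each entry of the deviation is at most M plus (D/n)·M per sample falling on it. Summed over
    -- the level this gives κ(y + 2y + 3t) with κ = MD/n.
    have hdev (a : α) : |deviation ω X a| ≤ M + D / n * ∑ i, if ω i = a then M else 0 := by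
      refine (abs_sub _ _).trans (add_le_add (hX a) ?_)
      rw [abs_mul, abs_of_pos (by positivity)]
      refine mul_le_mul_of_nonneg_left ?_ (by positivity)
      refine (Finset.abs_sum_le_sum_abs _ _).trans (Finset.sum_le_sum fun i _ => ?_)
      split_ifs
      exacts [hX a, by simp]
    calc ∑ p, level v w s p.2 * |deviation ω X (e.symm p)|
        = ∑ a, level v w s (e a).2 * |deviation ω X a| := by
          rw [← Equiv.sum_comp e]
          simp only [Equiv.symm_apply_apply]
      _ ≤ ∑ a, level v w s (e a).2 * (M + D / n * ∑ i, if ω i = a then M else 0) :=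
          Finset.sum_le_sum fun a _ => mul_le_mul_of_nonneg_left (hdev a) (level_nonneg _ _ _ _)
      _ = M * g + D / n * (M * ∑ i, level v w s (e (ω i)).2) := by
          have := sum_mul_deviation ω (fun _ => M) (fun a => level v w s (e a).2)
          simp only [deviation, mul_sub, Finset.sum_sub_distrib, ← Finset.sum_mul, hlev] at this
          simp only [mul_add, Finset.sum_add_distrib, ← Finset.sum_mul, hlev]
          linarith
      _ ≤ M * g + D / n * (M * (2 * (n / D * g) + 3 * t)) := by gcongr
      _ = M * D / n * (3 * (n / D * g) + 3 * t) := by field_simp; ring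

/-- Bernstein is applied with t = E₀ + θ·nnz to every pattern and every level. The weights sum to at
most e³ and e² respectively, and 2m(e³ + e²) ≤ 60m. -/
theorem measure_not_blockBound_le {α : Type*} [Fintype α] [DecidableEq α] [Nonempty α]
    [MeasurableSpace α] [MeasurableSingletonClass α] {Ω : Type*} [MeasurableSpace Ω]
    {P : Measure Ω} [IsProbabilityMeasure P] {n : ℕ} {ω : Fin n → Ω → α}
    (hm : ∀ i, Measurable (ω i)) (hind : iIndepFun ω P)
    (hu : ∀ i, P.map (ω i) = uniformOn Set.univ) (e : α ≃ I × J × H)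
    {K m : ℕ} (hn : 0 < n) {M θ E₀ : ℝ} (hM : 0 < M) (hθ : 0 ≤ θ) (hE : 0 < E₀) (X : α → ℝ)
    (hX : ∀ a, |X a| ≤ M) (hI : Fintype.card I * (2 * K * Real.exp (-θ)) ≤ 1)
    (hJ : Fintype.card J * (2 * K * Real.exp (-θ)) ≤ 1)
    (hH : Fintype.card H * (2 * K * Real.exp (-θ)) ≤ 1) :
    P.real {o | ¬ BlockBound K m (M * Fintype.card α / n) (n / Fintype.card α) θ E₀
      (fun p => deviation (fun i => ω i o) X (e.symm p))} ≤ 60 * m * Real.exp (-E₀) := by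
  set D : ℝ := (Fintype.card α : ℝ) with hDdef
  set A : (I → ℝ) → (J → ℝ) → (H → ℝ) → ℕ → Set Ω := fun u v w s =>
    {o | ¬ |∑ i, signPattern u v w s (e (ω i o)) * (X (ω i o) / M) -
        n * (∑ a, signPattern u v w s (e a) * (X a / M)) / D| ≤
        2 * √(n / D * (nnz u * levelCard v w s) *
          (E₀ + θ * (nnz u + nnz v + nnz w))) + 2 * (E₀ + θ * (nnz u + nnz v + nnz w))} with hA
  set B : (J → ℝ) → (H → ℝ) → ℕ → Set Ω := fun v w s =>
    {o | ¬ |∑ i, level v w s (e (ω i o)).2 - n * (∑ a, level v w s (e a).2) / D| ≤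
        2 * √(n / D * (Fintype.card I * levelCard v w s) *
          (E₀ + θ * (nnz v + nnz w))) + 2 * (E₀ + θ * (nnz v + nnz w))} with hB
  have hsub : {o | ¬ BlockBound K m (M * D / n) (n / D) θ E₀
      (fun p => deviation (fun i => ω i o) X (e.symm p))} ⊆
      (⋃ u ∈ digitVecs I K, ⋃ v ∈ digitVecs J K, ⋃ w ∈ digitVecs H K, ⋃ s ∈ Finset.range m,
        A u v w s) ∪ ⋃ v ∈ digitVecs J K, ⋃ w ∈ digitVecs H K, ⋃ s ∈ Finset.range m, B v w s := by
    intro o ho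
    by_contra hcon
    simp only [hA, hB, Set.mem_union, Set.mem_iUnion, not_or, not_exists, Set.mem_ofPred_eq,
      not_not] at hcon
    exact ho (blockBound_of_deviation e hn hM hθ hE.le X hX (fun i => ω i o)
      (fun u hu v hv w hw s hs => hcon.1 u hu v hv w hw s hs)
      (fun v hv w hw s hs => hcon.2 v hv w hw s hs))
  have hPA (u : I → ℝ) (v : J → ℝ) (w : H → ℝ) (s : ℕ) : P.real (A u v w s) ≤
      2 * Real.exp (-E₀) * (Real.exp (-(θ * nnz u)) * (Real.exp (-(θ * nnz v)) *
        Real.exp (-(θ * nnz w)))) := by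
    have h0 : 0 ≤ θ * (nnz u + nnz v + nnz w) :=
      mul_nonneg hθ (add_nonneg (add_nonneg (nnz_nonneg u) (nnz_nonneg v)) (nnz_nonneg w))
    have hXM (a : α) : |X a / M| ≤ 1 := by
      rw [abs_div, abs_of_pos hM, div_le_one hM]
      exact hX a
    refine (bernstein hm hind hu (fun a => signPattern u v w s (e a) * (X a / M)) (fun a => ?_)
      (V := n / D * (nnz u * levelCard v w s)) ?_ (by linarith)).trans (le_of_eq ?_)
    · rw [abs_mul]
      exact mul_le_one₀ (abs_signPattern_le_one _ _ _ _ _) (abs_nonneg _) (hXM a)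
    · rw [mul_div_right_comm]
      refine mul_le_mul_of_nonneg_left ?_ (by positivity)
      refine le_trans ?_ (sum_signPattern_sq_le u v w s)
      rw [← Equiv.sum_comp e]
      refine Finset.sum_le_sum fun a _ => ?_
      rw [mul_pow]
      exact mul_le_of_le_one_right (sq_nonneg _) ((sq_le_one_iff_abs_le_one _).2 (hXM a))
    · rw [mul_assoc, ← Real.exp_add, ← Real.exp_add, ← Real.exp_add]
      congr 2
      ring
  have hPB (v : J → ℝ) (w : H → ℝ) (s : ℕ) : P.real (B v w s) ≤
      2 * Real.exp (-E₀) * (Real.exp (-(θ * nnz v)) * Real.exp (-(θ * nnz w))) := by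
    have h0 : 0 ≤ θ * (nnz v + nnz w) :=
      mul_nonneg hθ (add_nonneg (nnz_nonneg v) (nnz_nonneg w))
    refine (bernstein hm hind hu (fun a => level v w s (e a).2) (fun a => ?_)
      (V := n / D * (Fintype.card I * levelCard v w s)) ?_ (by linarith)).trans (le_of_eq ?_)
    · rw [abs_of_nonneg (level_nonneg _ _ _ _)]
      exact level_le_one _ _ _ _
    · rw [mul_div_right_comm]
      refine mul_le_mul_of_nonneg_left ?_ (by positivity)
      rw [← sum_level_eq, ← Equiv.sum_comp e]
      refine Finset.sum_le_sum fun a _ => ?_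
      rw [sq]
      exact mul_le_of_le_one_left (level_nonneg _ _ _ _) (level_le_one _ _ _ _)
    · rw [mul_assoc, ← Real.exp_add, ← Real.exp_add]
      congr 2
      ring
  have hI' := sum_exp_nnz_le K hI
  have hJ' := sum_exp_nnz_le K hJ
  have hH' := sum_exp_nnz_le K hH
  have h1 : P.real (⋃ u ∈ digitVecs I K, ⋃ v ∈ digitVecs J K, ⋃ w ∈ digitVecs H K,
      ⋃ s ∈ Finset.range m, A u v w s) ≤ m * (2 * Real.exp (-E₀)) *
        (Real.exp 1 * (Real.exp 1 * Real.exp 1)) := by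
    calc _ ≤ ∑ u ∈ digitVecs I K, ∑ v ∈ digitVecs J K, ∑ w ∈ digitVecs H K,
        ∑ s ∈ Finset.range m, 2 * Real.exp (-E₀) * (Real.exp (-(θ * nnz u)) *
          (Real.exp (-(θ * nnz v)) * Real.exp (-(θ * nnz w)))) := by
          refine (measureReal_biUnion_finset_le _ _).trans (Finset.sum_le_sum fun u _ => ?_)
          refine (measureReal_biUnion_finset_le _ _).trans (Finset.sum_le_sum fun v _ => ?_)
          refine (measureReal_biUnion_finset_le _ _).trans (Finset.sum_le_sum fun w _ => ?_)
          exact (measureReal_biUnion_finset_le _ _).trans (Finset.sum_le_sum fun s _ => hPA u v w s)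
      _ = m * (2 * Real.exp (-E₀)) * ((∑ u ∈ digitVecs I K, Real.exp (-(θ * nnz u))) *
          ((∑ v ∈ digitVecs J K, Real.exp (-(θ * nnz v))) *
            ∑ w ∈ digitVecs H K, Real.exp (-(θ * nnz w)))) := by
          simp only [Finset.sum_const, Finset.card_range, nsmul_eq_mul, ← Finset.mul_sum,
            ← Finset.sum_mul]
          ring
      _ ≤ _ := by gcongr
  have h2 : P.real (⋃ v ∈ digitVecs J K, ⋃ w ∈ digitVecs H K,
      ⋃ s ∈ Finset.range m, B v w s) ≤ m * (2 * Real.exp (-E₀)) *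
        (Real.exp 1 * Real.exp 1) := by
    calc _ ≤ ∑ v ∈ digitVecs J K, ∑ w ∈ digitVecs H K,
        ∑ s ∈ Finset.range m, 2 * Real.exp (-E₀) *
          (Real.exp (-(θ * nnz v)) * Real.exp (-(θ * nnz w))) := by
          refine (measureReal_biUnion_finset_le _ _).trans (Finset.sum_le_sum fun v _ => ?_)
          refine (measureReal_biUnion_finset_le _ _).trans (Finset.sum_le_sum fun w _ => ?_)
          exact (measureReal_biUnion_finset_le _ _).trans (Finset.sum_le_sum fun s _ => hPB v w s)
      _ = m * (2 * Real.exp (-E₀)) *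
          ((∑ v ∈ digitVecs J K, Real.exp (-(θ * nnz v))) *
            ∑ w ∈ digitVecs H K, Real.exp (-(θ * nnz w))) := by
          simp only [Finset.sum_const, Finset.card_range, nsmul_eq_mul, ← Finset.mul_sum,
            ← Finset.sum_mul]
          ring
      _ ≤ _ := by gcongr
  refine (measureReal_mono hsub).trans ((measureReal_union_le _ _).trans ?_)
  have hc : Real.exp 1 * (Real.exp 1 * Real.exp 1) + Real.exp 1 * Real.exp 1 ≤ 30 := by
    have h3 : Real.exp 1 ≤ 2.72 := by linarith [Real.exp_one_lt_d9]
    have h4 : Real.exp 1 * Real.exp 1 ≤ 2.72 * 2.72 := by gcongr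
    have h5 : Real.exp 1 * (Real.exp 1 * Real.exp 1) ≤ 2.72 * (2.72 * 2.72) := by gcongr
    linarith
  calc _ ≤ m * (2 * Real.exp (-E₀)) *
        (Real.exp 1 * (Real.exp 1 * Real.exp 1) + Real.exp 1 * Real.exp 1) := by
        rw [mul_add]; exact add_le_add h1 h2
    _ ≤ m * (2 * Real.exp (-E₀)) * 30 := by gcongr
    _ = _ := by ring

end Sampling

/-! ### Assembling the three regions of the trilinear form. -/

/-- The common bound for the three regions of the trilinear form. -/
noncomputable def regionBound (K : ℕ) (κ τ θ E₀ N : ℝ) : ℝ :=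
  κ * (6 * K * (5 * √(θ * τ * N) + 2 * √(τ * E₀)) + 40 * E₀ + 100 * θ)

theorem regionBound_mono {K : ℕ} {κ τ θ E₀ N N' : ℝ} (hκ : 0 ≤ κ) (hτ : 0 ≤ τ) (hθ : 0 ≤ θ)
    (h : N ≤ N') : regionBound K κ τ θ E₀ N ≤ regionBound K κ τ θ E₀ N' := by
  unfold regionBound
  gcongr

/-- The trilinear form is split according to which of the three entries is the smallest. -/
theorem digit_trilinear_le {K : ℕ} {κ τ θ E₀ N : ℝ} (hκ : 0 ≤ κ) (hτ : 0 ≤ τ) (hθ : 0 ≤ θ)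
    (hE : 0 ≤ E₀) (hI : (Fintype.card I : ℝ) ≤ N) (hJ : (Fintype.card J : ℝ) ≤ N)
    (hH : (Fintype.card H : ℝ) ≤ N) {Y : I × J × H → ℝ}
    (h1 : BlockBound K (2 * K) κ τ θ E₀ Y)
    (h2 : BlockBound K (2 * K) κ τ θ E₀ (fun q : J × I × H => Y (q.2.1, q.1, q.2.2)))
    (h3 : BlockBound K (2 * K) κ τ θ E₀ (fun q : H × I × J => Y (q.2.1, q.2.2, q.1)))
    {u : I → ℝ} {v : J → ℝ} {w : H → ℝ} (hu : ∀ i, u i ∈ digits K) (hv : ∀ i, v i ∈ digits K)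
    (hw : ∀ i, w i ∈ digits K)
    (hu1 : ∑ i, u i ^ 2 ≤ 1) (hv1 : ∑ i, v i ^ 2 ≤ 1) (hw1 : ∑ i, w i ^ 2 ≤ 1) :
    ∑ p, u p.1 * v p.2.1 * w p.2.2 * Y p ≤ 3 * regionBound K κ τ θ E₀ N := by
  classical
  -- The mix of ≤ and < breaks ties, so that every position lies in exactly one region.
  have a1 := (abs_le.1 (abs_region_le hκ hτ hθ hE h1 (R₂ := fun x y => x ≤ y)
    (R₃ := fun x y => x ≤ y) (fun _ _ h => h) (fun _ _ h => h) hu hv hw hu1 hv1 hw1)).2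
  have a2 := (abs_le.1 (abs_region_le hκ hτ hθ hE h2 (R₂ := fun x y => x < y)
    (R₃ := fun x y => x ≤ y) (fun _ _ h => h.le) (fun _ _ h => h) hv hu hw hv1 hu1 hw1)).2
  have a3 := (abs_le.1 (abs_region_le hκ hτ hθ hE h3 (R₂ := fun x y => x < y)
    (R₃ := fun x y => x < y) (fun _ _ h => h.le) (fun _ _ h => h.le) hw hu hv hw1 hu1 hv1)).2
  have b1 := a1.trans (regionBound_mono (K := K) (E₀ := E₀) hκ hτ hθ hI)
  have b2 := a2.trans (regionBound_mono (K := K) (E₀ := E₀) hκ hτ hθ hJ)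
  have b3 := a3.trans (regionBound_mono (K := K) (E₀ := E₀) hκ hτ hθ hH)
  let e₂ : I × J × H ≃ J × I × H :=
    ⟨fun p => (p.2.1, p.1, p.2.2), fun q => (q.2.1, q.1, q.2.2), fun _ => rfl, fun _ => rfl⟩
  let e₃ : I × J × H ≃ H × I × J :=
    ⟨fun p => (p.2.2, p.1, p.2.1), fun q => (q.2.1, q.2.2, q.1), fun _ => rfl, fun _ => rfl⟩
  rw [← Equiv.sum_comp e₂] at b2
  rw [← Equiv.sum_comp e₃] at b3
  have key := add_le_add (add_le_add b1 b2) b3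
  rw [← Finset.sum_add_distrib, ← Finset.sum_add_distrib] at key
  refine le_trans (le_of_eq (Finset.sum_congr rfl fun p _ => ?_)) (key.trans (by linarith))
  obtain ⟨i, j, h⟩ := p
  simp only [e₂, e₃, Equiv.coe_fn_mk]
  rw [← add_mul, ← add_mul]
  congr 1
  by_cases c1 : |u i| ≤ |v j| <;> by_cases c2 : |u i| ≤ |w h| <;>
    by_cases c3 : |v j| ≤ |w h|
  any_goals
    simp only [← not_le, c1, c2, c3, not_true_eq_false, not_false_eq_true, and_self, and_true,
      and_false, if_true, if_false]
    ring1
  -- The two remaining sign combinations are cyclic orders and cannot occur.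
  · exact absurd (c1.trans c3) c2
  · exact absurd (c2.trans (not_le.1 c3).le) c1

/-! ### Tail bound for the spectral norm of the sampling operator. -/

section Sampling

variable {d₁ d₂ d₃ : ℕ}

theorem dot_outer_eq_sum (X : Tensor3 d₁ d₂ d₃) (u : EuclideanSpace ℝ (Fin d₁))
    (v : EuclideanSpace ℝ (Fin d₂)) (w : EuclideanSpace ℝ (Fin d₃)) :
    dot X (outer u v w) =
      ∑ p : TIdx d₁ d₂ d₃, u p.1 * v p.2.1 * w p.2.2 * X p.1 p.2.1 p.2.2 := by
  simp only [dot, outer, Fintype.sum_prod_type]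
  exact Finset.sum_congr rfl fun _ _ => Finset.sum_congr rfl fun _ _ =>
    Finset.sum_congr rfl fun _ _ => mul_comm _ _

theorem sampleR_apply {n : ℕ} (ω : Fin n → TIdx d₁ d₂ d₃) (X : Tensor3 d₁ d₂ d₃)
    (p : TIdx d₁ d₂ d₃) : sampleR ω X p.1 p.2.1 p.2.2 =
      deviation ω (fun q => X q.1 q.2.1 q.2.2) p := by
  simp only [sampleR, deviation, Pi.sub_apply, Pi.smul_apply, Finset.sum_apply, entryProj,
    smul_eq_mul, Fintype.card_prod, Fintype.card_fin, Nat.cast_mul, Prod.mk.eta]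
  rw [← Finset.mul_sum]
  simp only [eq_comm (a := p)]
  ring

theorem spectralNorm_le_of_blockBound {K : ℕ} {κ τ θ E₀ N : ℝ} (hκ : 0 ≤ κ) (hτ : 0 ≤ τ)
    (hθ : 0 ≤ θ) (hE : 0 ≤ E₀) (hd₁ : (d₁ : ℝ) ≤ N) (hd₂ : (d₂ : ℝ) ≤ N) (hd₃ : (d₃ : ℝ) ≤ N)
    (hK : N * (1 / 4) ^ K ≤ 1 / 2) {Y : TIdx d₁ d₂ d₃ → ℝ}
    (h1 : BlockBound (K + 1) (2 * (K + 1)) κ τ θ E₀ Y)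
    (h2 : BlockBound (K + 1) (2 * (K + 1)) κ τ θ E₀
      (fun q : Fin d₂ × Fin d₁ × Fin d₃ => Y (q.2.1, q.1, q.2.2)))
    (h3 : BlockBound (K + 1) (2 * (K + 1)) κ τ θ E₀
      (fun q : Fin d₃ × Fin d₁ × Fin d₂ => Y (q.2.1, q.2.2, q.1)))
    {X : Tensor3 d₁ d₂ d₃} (hXY : ∀ p : TIdx d₁ d₂ d₃, X p.1 p.2.1 p.2.2 = Y p) :
    spectralNorm X ≤ 64 * (3 * regionBound (K + 1) κ τ θ E₀ N) := by
  have hcard {m : ℕ} (hm : (m : ℝ) ≤ N) : (Fintype.card (Fin m) : ℝ) * (1 / 4) ^ K ≤ 1 / 2 := by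
    rw [Fintype.card_fin]
    exact (mul_le_mul_of_nonneg_right hm (by positivity)).trans hK
  refine Real.sSup_le ?_ (by unfold regionBound; positivity)
  rintro x ⟨u, v, w, hu, hv, hw, rfl⟩
  have hsq {m : ℕ} {z : EuclideanSpace ℝ (Fin m)} (hz : ‖z‖ = 1) : ∑ i, z i ^ 2 ≤ 1 := by
    rw [← EuclideanSpace.real_norm_sq_eq, hz]; norm_num
  rw [dot_outer_eq_sum]
  simp only [hXY]
  refine trilinear_le_of_digits K (hcard hd₁) (hcard hd₂) (hcard hd₃) Y _ ?_ u v w (hsq hu)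
    (hsq hv) (hsq hw)
  intro u v w hu hv hw hu1 hv1 hw1
  exact digit_trilinear_le hκ hτ hθ hE (by simpa using hd₁) (by simpa using hd₂)
    (by simpa using hd₃) h1 h2 h3 hu hv hw hu1 hv1 hw1

/-- Tail bound for the spectral norm of the sampling deviation of a bounded tensor. -/
theorem measure_spectralNorm_sampleR_le {Ω : Type*} [MeasurableSpace Ω] {P : Measure Ω}
    [IsProbabilityMeasure P] {n : ℕ} {ω : Fin n → Ω → TIdx d₁ d₂ d₃}
    (hm : ∀ i, Measurable (ω i)) (hind : iIndepFun ω P)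
    (hu : ∀ i, P.map (ω i) = uniformOn Set.univ) [Nonempty (TIdx d₁ d₂ d₃)] (hn : 0 < n)
    {K : ℕ} {M θ E₀ N x : ℝ} (hM : 0 < M) (hθ : 0 ≤ θ) (hE : 0 < E₀)
    (hd₁ : (d₁ : ℝ) ≤ N) (hd₂ : (d₂ : ℝ) ≤ N) (hd₃ : (d₃ : ℝ) ≤ N)
    (hK : N * (1 / 4) ^ K ≤ 1 / 2) (hN : N * (2 * (K + 1 : ℕ) * Real.exp (-θ)) ≤ 1)
    {X : Tensor3 d₁ d₂ d₃} (hX : ∀ a b c, |X a b c| ≤ M)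
    (hx : 64 * (3 * regionBound (K + 1) (M * ((d₁ : ℝ) * d₂ * d₃) / n)
      (n / ((d₁ : ℝ) * d₂ * d₃)) θ E₀ N) < x) :
    P.real {o | x ≤ spectralNorm (sampleR (fun i => ω i o) X)} ≤
      360 * (K + 1 : ℕ) * Real.exp (-E₀) := by
  set Xf : TIdx d₁ d₂ d₃ → ℝ := fun q => X q.1 q.2.1 q.2.2 with hXf
  have hXM (p : TIdx d₁ d₂ d₃) : |Xf p| ≤ M := hX _ _ _
  have hcard : (Fintype.card (TIdx d₁ d₂ d₃) : ℝ) = (d₁ : ℝ) * d₂ * d₃ := by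
    simp [mul_assoc]
  have hcN {m : ℕ} (hm : (m : ℝ) ≤ N) :
      (Fintype.card (Fin m) : ℝ) * (2 * (K + 1 : ℕ) * Real.exp (-θ)) ≤ 1 := by
    rw [Fintype.card_fin]
    exact (mul_le_mul_of_nonneg_right hm (by positivity)).trans hN
  let e₂ : TIdx d₁ d₂ d₃ ≃ Fin d₂ × Fin d₁ × Fin d₃ :=
    ⟨fun p => (p.2.1, p.1, p.2.2), fun q => (q.2.1, q.1, q.2.2), fun _ => rfl, fun _ => rfl⟩
  let e₃ : TIdx d₁ d₂ d₃ ≃ Fin d₃ × Fin d₁ × Fin d₂ :=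
    ⟨fun p => (p.2.2, p.1, p.2.1), fun q => (q.2.1, q.2.2, q.1), fun _ => rfl, fun _ => rfl⟩
  -- Each arrangement puts a different factor in the slot of the smallest entry. Three of them with
  -- m = 2(K+1) levels give 3·60·2 = 360.
  have p1 := measure_not_blockBound_le hm hind hu (Equiv.refl _) (K := K + 1) (m := 2 * (K + 1))
    hn hM hθ hE Xf hXM (hcN hd₁) (hcN hd₂) (hcN hd₃)
  have p2 := measure_not_blockBound_le hm hind hu e₂ (K := K + 1) (m := 2 * (K + 1))
    hn hM hθ hE Xf hXM (hcN hd₂) (hcN hd₁) (hcN hd₃)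
  have p3 := measure_not_blockBound_le hm hind hu e₃ (K := K + 1) (m := 2 * (K + 1))
    hn hM hθ hE Xf hXM (hcN hd₃) (hcN hd₁) (hcN hd₂)
  rw [hcard] at p1 p2 p3
  refine (measureReal_mono (s₂ := (_ ∪ _) ∪ _) ?_).trans ((measureReal_union_le _ _).trans
    (add_le_add ((measureReal_union_le _ _).trans (add_le_add p1 p2)) p3 |>.trans (le_of_eq ?_)))
  · intro o ho
    by_contra hcon
    simp only [Set.mem_union, Set.mem_ofPred_eq, not_or, not_not] at hcon ho
    have := spectralNorm_le_of_blockBound (by positivity) (by positivity) hθ hE.le hd₁ hd₂ hd₃ hK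
      hcon.1.1 hcon.1.2 hcon.2 (X := sampleR (fun i => ω i o) X)
      (fun p => sampleR_apply (fun i => ω i o) X p)
    exact absurd (ho.trans this) (not_le.2 hx)
  · push_cast
    ring

/-! ### Coherence and nondegeneracy of the dual tensor. -/

theorem spectralNorm_zero_le : spectralNorm (0 : Tensor3 d₁ d₂ d₃) ≤ 0 := by
  refine Real.sSup_le ?_ le_rfl
  rintro x ⟨u, v, w, -, -, -, rfl⟩
  simp [dot]

theorem IsDual.ne_zero {T W : Tensor3 d₁ d₂ d₃} (h : IsDual T W) : W ≠ 0 := by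
  rintro rfl
  have := spectralNorm_zero_le (d₁ := d₁) (d₂ := d₂) (d₃ := d₃)
  rw [h.2.1] at this
  linarith

theorem fiberSpan_eq_bot_of_zero : fiberSpan₁ (0 : Tensor3 d₁ d₂ d₃) = ⊥ := by
  rw [fiberSpan₁, Submodule.span_eq_bot]
  rintro x ⟨b, c, rfl⟩
  ext i
  simp [fiber₁]

theorem Q0_zero_left (X : Tensor3 d₁ d₂ d₃) : Q0 0 X = 0 := by
  funext a b c
  simp [Q0, prodMap, mul₁, fiberSpan_eq_bot_of_zero]

theorem abs_le_maxNorm (X : Tensor3 d₁ d₂ d₃) (a : Fin d₁) (b : Fin d₂) (c : Fin d₃) :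
    |X a b c| ≤ maxNorm X :=
  le_ciSup (f := fun ω : TIdx d₁ d₂ d₃ => |X ω.1 ω.2.1 ω.2.2|) (Set.finite_range _).bddAbove
    (a, b, c)

theorem tuckerRank_pos {T : Tensor3 d₁ d₂ d₃} (hT : T ≠ 0) :
    0 < tuckerRank₁ T ∧ 0 < tuckerRank₂ T ∧ 0 < tuckerRank₃ T := by
  have h : ∃ a b c, T a b c ≠ 0 := by
    by_contra! hcon
    exact hT (by funext a b c; exact hcon a b c)
  obtain ⟨a, b, c, habc⟩ := h
  refine ⟨Nat.pos_of_ne_zero fun h0 => habc ?_, Nat.pos_of_ne_zero fun h0 => habc ?_,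
    Nat.pos_of_ne_zero fun h0 => habc ?_⟩
  · rw [tuckerRank₁, Submodule.finrank_eq_zero, fiberSpan₁, Submodule.span_eq_bot] at h0
    simpa [fiber₁] using congrArg (fun z => z a) (h0 _ ⟨b, c, rfl⟩)
  · rw [tuckerRank₂, Submodule.finrank_eq_zero, fiberSpan₂, Submodule.span_eq_bot] at h0
    simpa [fiber₂] using congrArg (fun z => z b) (h0 _ ⟨a, c, rfl⟩)
  · rw [tuckerRank₃, Submodule.finrank_eq_zero, fiberSpan₃, Submodule.span_eq_bot] at h0
    simpa [fiber₃] using congrArg (fun z => z c) (h0 _ ⟨a, b, rfl⟩)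

/-- Needed because `alpha` divides by `rbar`. If T were zero, then `Q0 T` would vanish and force W =
0, against ‖W‖ = 1. -/
theorem IsDual.rbar_pos {T W : Tensor3 d₁ d₂ d₃} (h : IsDual T W) (h₁ : 0 < d₁) :
    0 < rbar T := by
  have hT : T ≠ 0 := by
    rintro rfl
    exact h.ne_zero (by rw [← h.1, Q0_zero_left])
  obtain ⟨r1, r2, r3⟩ := tuckerRank_pos hT
  have r1' : (0 : ℝ) < tuckerRank₁ T := by exact_mod_cast r1
  have r2' : (0 : ℝ) < tuckerRank₂ T := by exact_mod_cast r2
  have r3' : (0 : ℝ) < tuckerRank₃ T := by exact_mod_cast r3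
  have h₁' : (0 : ℝ) < d₁ := by exact_mod_cast h₁
  unfold rbar
  positivity

/-- The coherence controls the maximum norm of the dual tensor. -/
theorem mul_maxNorm_sq_le {T W : Tensor3 d₁ d₂ d₃} {α₀ : ℝ} (hα : alpha T W ≤ α₀)
    (hM : 0 ≤ maxNorm W) (hr : 0 < rbar T) :
    ((d₁ : ℝ) * d₂ * d₃) * maxNorm W ^ 2 ≤ α₀ ^ 2 * rbar T := by
  have h0 : 0 ≤ alpha T W := mul_nonneg (Real.sqrt_nonneg _) hM
  have h1 : alpha T W ^ 2 ≤ α₀ ^ 2 := by gcongr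
  rw [alpha, mul_pow, Real.sq_sqrt (by positivity), div_mul_eq_mul_div, div_le_iff₀ hr] at h1
  exact h1

end Sampling

/-! ### Choice of parameters and numerical estimates. -/

/-- With κ = MD/n and τ = n/D, κ²τ = DM²/n, so the square root terms are controlled by `hA`. The
linear terms are of order κL(1 + β) and are controlled by `hB`. -/
theorem regionBound_lt {K : ℕ} {D M n L β N : ℝ} (hD : 0 < D) (hM : 0 < M) (hn : 0 < n)
    (hL : 1 ≤ L) (hLN : L ≤ N) (hβ : 0 < β) (hK : (K : ℝ) ≤ 4 * L)
    (hA : 10 ^ 14 * ((β + L) ^ 2 * L * (D * M ^ 2) * N) ≤ n)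
    (hB : 10 ^ 14 * (D * M * (L * (1 + β))) ≤ n) :
    64 * (3 * regionBound K (M * D / n) (n / D) (4 * L) ((β + 10) * L) N) < 1 / 8 := by
  have hL0 : 0 < L := by linarith
  have hN0 : 0 < N := by linarith
  set κ := M * D / n with hκ
  have hκ0 : 0 < κ := by positivity
  set Z := (β + L) ^ 2 * L * (D * M ^ 2) * N with hZ
  have hZn : Z / n ≤ 1 / 10 ^ 14 := by
    rw [div_le_div_iff₀ hn (by positivity)]
    linarith
  have hK2 : (K : ℝ) ^ 2 ≤ 16 * L ^ 2 := by
    have : (0 : ℝ) ≤ K := by positivity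
    nlinarith
  have t1 : κ * K * √(4 * L * (n / D) * N) ≤ 1 / 10 ^ 6 := by
    refine abs_le_of_sq_le_sq' ?_ (by positivity) |>.2
    rw [mul_pow, Real.sq_sqrt (by positivity)]
    calc (κ * K) ^ 2 * (4 * L * (n / D) * N) = 4 * L * N * (D * M ^ 2) / n * (K : ℝ) ^ 2 := by
          rw [hκ]; field_simp
      _ ≤ 4 * L * N * (D * M ^ 2) / n * (16 * L ^ 2) := by gcongr
      _ = 64 * (L ^ 2 * L * (D * M ^ 2) * N / n) := by ring
      _ ≤ 64 * (Z / n) := by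
          rw [hZ]
          gcongr
          linarith
      _ ≤ _ := by linarith
  have t2 : κ * K * √(n / D * ((β + 10) * L)) ≤ 2 / 10 ^ 6 := by
    refine abs_le_of_sq_le_sq' ?_ (by positivity) |>.2
    rw [mul_pow, Real.sq_sqrt (by positivity)]
    have hb : L ^ 2 * (β + 10) ≤ 11 * ((β + L) ^ 2 * N) := by
      have h1 : β * L * L ≤ β * L * N := by gcongr
      have h2 : L ^ 2 * 1 ≤ L ^ 2 * N := by gcongr; linarith
      have h3 : 0 ≤ β ^ 2 * N := by positivity
      have h4 : 0 ≤ β * L * N := by positivity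
      nlinarith
    calc (κ * K) ^ 2 * (n / D * ((β + 10) * L))
        = (β + 10) * L * (D * M ^ 2) / n * (K : ℝ) ^ 2 := by
          rw [hκ]; field_simp
      _ ≤ (β + 10) * L * (D * M ^ 2) / n * (16 * L ^ 2) := by gcongr
      _ = 16 * ((L ^ 2 * (β + 10)) * (L * (D * M ^ 2)) / n) := by ring
      _ ≤ 16 * ((11 * ((β + L) ^ 2 * N)) * (L * (D * M ^ 2)) / n) := by gcongr
      _ = 176 * (Z / n) := by rw [hZ]; ring
      _ ≤ _ := by linarith
  have t3 : κ * (L * (1 + β)) ≤ 1 / 10 ^ 14 := by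
    rw [hκ, div_mul_eq_mul_div, div_le_div_iff₀ hn (by positivity)]
    linarith
  -- The linear part is 40(β + 10)L + 400L = 800L(1 + β) - 760Lβ.
  have e : regionBound K κ (n / D) (4 * L) ((β + 10) * L) N =
      30 * (κ * K * √(4 * L * (n / D) * N)) + 12 * (κ * K * √(n / D * ((β + 10) * L))) +
        (800 * (κ * (L * (1 + β))) - 760 * (κ * L * β)) := by
    unfold regionBound; ring
  have : 0 ≤ κ * L * β := by positivity
  rw [e]
  linarith

theorem natLog_add_two_le {N : ℕ} (hN : 1 ≤ N) (hL : 1 ≤ Real.log N) :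
    ((Nat.log 2 N + 1 + 1 : ℕ) : ℝ) ≤ 4 * Real.log N := by
  have h1 : (2 : ℝ) ^ Nat.log 2 N ≤ N := by exact_mod_cast Nat.pow_log_le_self 2 (by omega)
  have h2 := Real.log_le_log (by positivity) h1
  rw [Real.log_pow] at h2
  have h3 := Real.log_two_gt_d9
  have h4 : (0 : ℝ) ≤ Nat.log 2 N := by positivity
  push_cast
  nlinarith

theorem mul_quarter_pow_natLog_le {N : ℕ} (hN : 2 ≤ N) :
    (N : ℝ) * (1 / 4) ^ (Nat.log 2 N + 1) ≤ 1 / 2 := by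
  have h1 : (N : ℝ) ≤ 2 ^ (Nat.log 2 N + 1) := by
    exact_mod_cast (Nat.lt_pow_succ_log_self (by norm_num) N).le
  have h2 : (2 : ℝ) ≤ N := by exact_mod_cast hN
  generalize Nat.log 2 N + 1 = K at h1
  rw [one_div, inv_pow, show (4 : ℝ) = 2 ^ 2 by norm_num, ← pow_mul, mul_comm 2 K, pow_mul,
    ← div_eq_mul_inv, div_le_iff₀ (by positivity)]
  nlinarith

theorem log_mul_le_sq {β L : ℝ} (hβ : 0 < β) (hL : 1 ≤ L) : L * (1 + β) ≤ (β + L) ^ 2 := by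
  nlinarith [mul_pos hβ (zero_lt_one.trans_le hL)]

end Tensor3

/-! ### The theorem. -/

theorem lemma7 :
    ∃ c₁ : ℝ, 0 < c₁ ∧
      ∀ (d₁ d₂ d₃ : ℕ) (d : ℝ), d = (d₁ : ℝ) + d₂ + d₃ →
      ∀ (T W : Tensor3 d₁ d₂ d₃), Tensor3.IsDual T W →
      ∀ (α₀ r : ℝ), Tensor3.alpha T W ≤ α₀ → Tensor3.rbar T = r →
      ∀ (β δ₁ : ℝ), 0 < β → 1 / Real.log d ≤ δ₁ → δ₁ < 1 →
      ∀ n₁ : ℕ,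
        c₁ * (qStar β α₀ r d * d ^ (1 + δ₁)
          + √(qStar β α₀ r d * (1 + β) * δ₁⁻¹ * ((d₁ : ℝ) * d₂ * d₃))) ≤ (n₁ : ℝ) →
      ∀ (Ω : Type*) [MeasurableSpace Ω] (P : Measure Ω) [IsProbabilityMeasure P]
        (ω : Fin n₁ → Ω → TIdx d₁ d₂ d₃),
        (∀ i, Measurable (ω i)) → iIndepFun ω P →
        (∀ i, P.map (ω i) = uniformOn Set.univ) →
      ∀ X : Tensor3 d₁ d₂ d₃, Tensor3.Q T X = X →
        Tensor3.maxNorm X ≤ Tensor3.maxNorm W →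
        P.real {o | 1 / 8 ≤ Tensor3.spectralNorm (Tensor3.sampleR (fun i => ω i o) X)}
          ≤ d ^ (-β - 1) := by
  refine ⟨10 ^ 14, by norm_num, ?_⟩
  intro d₁ d₂ d₃ d hd T W hTW α₀ r hα hr β δ₁ hβ hδ hδ1 n hn Ω _ P _ ω hm hind hunif X _ hXW
  -- A nonzero entry of W makes all three dimensions and M positive.
  obtain ⟨a, b, c, hW⟩ : ∃ a b c, W a b c ≠ 0 := by
    by_contra! hcon
    exact hTW.ne_zero (by funext a b c; exact hcon a b c)
  have hnat₁ : 1 ≤ d₁ := Fin.pos a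
  have hnat₂ : 1 ≤ d₂ := Fin.pos b
  have hnat₃ : 1 ≤ d₃ := Fin.pos c
  have : Nonempty (TIdx d₁ d₂ d₃) := ⟨(a, b, c)⟩
  have hr₁ : (1 : ℝ) ≤ d₁ := by exact_mod_cast hnat₁
  have hr₂ : (1 : ℝ) ≤ d₂ := by exact_mod_cast hnat₂
  have hr₃ : (1 : ℝ) ≤ d₃ := by exact_mod_cast hnat₃
  have hd3 : 3 ≤ d := by linarith
  have hd0 : 0 < d := by linarith
  set M := Tensor3.maxNorm W with hM
  have hM0 : 0 < M := (abs_pos.2 hW).trans_le (Tensor3.abs_le_maxNorm W a b c)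
  have hrpos : 0 < r := hr ▸ hTW.rbar_pos hnat₁
  set D : ℝ := (d₁ : ℝ) * d₂ * d₃ with hD
  have hD0 : 0 < D := by positivity
  have hcoh : D * M ^ 2 ≤ α₀ ^ 2 * r := hr ▸ Tensor3.mul_maxNorm_sq_le hα hM0.le (hr ▸ hrpos)
  set L := Real.log d with hL
  have hL1 : 1 ≤ L := by
    rw [hL, Real.le_log_iff_exp_le hd0]
    linarith [Real.exp_one_lt_d9]
  have hL0 : 0 < L := by linarith
  have hLd : L ≤ d := by
    have := Real.log_le_sub_one_of_pos hd0
    linarith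
  have hexpL : Real.exp L = d := Real.exp_log hd0
  have hδ0 : 0 < δ₁ := lt_of_lt_of_le (by positivity) hδ
  have hq : (β + L) ^ 2 * L * (D * M ^ 2) ≤ qStar β α₀ r d := by
    rw [qStar, ← hL]
    calc (β + L) ^ 2 * L * (D * M ^ 2) ≤ (β + L) ^ 2 * L * (α₀ ^ 2 * r) := by gcongr
      _ = _ := by ring
  have hq0 : 0 < qStar β α₀ r d := lt_of_lt_of_le (by positivity) hq
  have hA : 10 ^ 14 * ((β + L) ^ 2 * L * (D * M ^ 2) * d) ≤ n := by
    refine le_trans ?_ hn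
    have h1 : d ≤ d ^ (1 + δ₁) := by
      conv_lhs => rw [← Real.rpow_one d]
      exact Real.rpow_le_rpow_of_exponent_le (by linarith) (by linarith)
    have h2 : (β + L) ^ 2 * L * (D * M ^ 2) * d ≤ qStar β α₀ r d * d ^ (1 + δ₁) := by gcongr
    have := Real.sqrt_nonneg (qStar β α₀ r d * (1 + β) * δ₁⁻¹ * D)
    linarith
  have hB : 10 ^ 14 * (D * M * (L * (1 + β))) ≤ n := by
    refine le_trans ?_ hn
    -- After squaring, one factor L(1 + β) is traded for (β + L)², which completes `qStar`.
    have h1 : D * M * (L * (1 + β)) ≤ √(qStar β α₀ r d * (1 + β) * δ₁⁻¹ * D) := by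
      refine Real.le_sqrt_of_sq_le ?_
      have h2 := Tensor3.log_mul_le_sq hβ hL1
      have h3 : 1 ≤ δ₁⁻¹ := (one_le_inv₀ hδ0).2 hδ1.le
      calc (D * M * (L * (1 + β))) ^ 2
          = (L * (1 + β)) * (L * (D * M ^ 2)) * (1 + β) * 1 * D := by ring
        _ ≤ (β + L) ^ 2 * (L * (D * M ^ 2)) * (1 + β) * δ₁⁻¹ * D := by gcongr
        _ = (β + L) ^ 2 * L * (D * M ^ 2) * (1 + β) * δ₁⁻¹ * D := by ring
        _ ≤ _ := by gcongr
    have h2 : 0 ≤ qStar β α₀ r d * d ^ (1 + δ₁) := by positivity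
    linarith
  have hn0 : (0 : ℝ) < n := lt_of_lt_of_le (by positivity) hA
  set N : ℕ := d₁ + d₂ + d₃ with hN
  have hNd : (N : ℝ) = d := by rw [hN, hd]; push_cast; ring
  -- Then d ≤ 2ᴷ, so d·4⁻ᴷ ≤ 1/2, while K + 1 stays of order log d.
  set K := Nat.log 2 N + 1 with hK
  have hKL : ((K + 1 : ℕ) : ℝ) ≤ 4 * L := by
    have := Tensor3.natLog_add_two_le (N := N) (by omega) (by rwa [hNd])
    rwa [hNd] at this
  have hK4 : d * (1 / 4) ^ K ≤ 1 / 2 := by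
    have := Tensor3.mul_quarter_pow_natLog_le (N := N) (by omega)
    rwa [hNd] at this
  have hexp (k : ℕ) : Real.exp (-(k * L)) = (d ^ k)⁻¹ := by
    rw [Real.exp_neg, Real.exp_nat_mul, hexpL]
  -- The price θ = 4L per coordinate gives e^{-θ} = d⁻⁴, against at most 2(K + 1)d ≤ 8d² choices of
  -- a coordinate and a nonzero digit.
  have hθ : d * (2 * (K + 1 : ℕ) * Real.exp (-(4 * L))) ≤ 1 := by
    have := hexp 4
    rw [Nat.cast_ofNat] at this
    rw [this]
    calc d * (2 * (K + 1 : ℕ) * (d ^ 4)⁻¹) ≤ d * (2 * (4 * d) * (d ^ 4)⁻¹) := by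
          gcongr
          linarith
      _ = 8 / d ^ 2 := by field_simp; ring
      _ ≤ 1 := by
        rw [div_le_one (by positivity)]
        exact (by norm_num : (8 : ℝ) ≤ 3 ^ 2).trans (by gcongr)
  -- E₀ = (β + 10)L gives e^{-E₀} = d^{-β-1}·d⁻⁹; the spare d⁻⁹ absorbs 360(K + 1) ≤ 1440d, since d
  -- ≥ 3.
  have hmain := Tensor3.measure_spectralNorm_sampleR_le hm hind hunif (by exact_mod_cast hn0)
    (K := K) (M := M) (θ := 4 * L) (E₀ := (β + 10) * L) (N := d) (x := 1 / 8) hM0 (by positivity)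
    (by positivity) (by linarith) (by linarith) (by linarith) hK4 hθ
    (fun a b c => (Tensor3.abs_le_maxNorm X a b c).trans hXW)
    (Tensor3.regionBound_lt hD0 hM0 hn0 hL1 hLd hβ hKL hA hB)
  refine hmain.trans ?_
  have h9 := hexp 9
  rw [Nat.cast_ofNat] at h9
  have e1 : Real.exp (-((β + 10) * L)) = d ^ (-β - 1) * (d ^ 9)⁻¹ := by
    rw [← h9, Real.rpow_def_of_pos hd0, ← Real.exp_add, ← hL]
    congr 1
    ring
  rw [e1]
  have h2 : 360 * ((K + 1 : ℕ) : ℝ) * (d ^ 9)⁻¹ ≤ 1 := by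
    calc 360 * ((K + 1 : ℕ) : ℝ) * (d ^ 9)⁻¹ ≤ 360 * (4 * d) * (d ^ 9)⁻¹ := by
          gcongr
          linarith
      _ = 1440 / d ^ 8 := by field_simp; ring
      _ ≤ 1 := by
        rw [div_le_one (by positivity)]
        calc (1440 : ℝ) ≤ 3 ^ 8 := by norm_num
          _ ≤ d ^ 8 := by gcongr
  have h3 : 0 ≤ d ^ (-β - 1) := by positivity
  calc _ = d ^ (-β - 1) * (360 * ((K + 1 : ℕ) : ℝ) * (d ^ 9)⁻¹) := by ring
    _ ≤ _ := mul_le_of_le_one_right h3 h2
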